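/- A derangement of $n$ symbols is a permutation of $\{1,\dots,n\}$ without fixed points. For $n\ge 2$ choose a derangement of $n$ symbols uniformly at random and let $S_n$ be the length of its shortest cycle; write ${}_S\mu_n=\mathbb{E}[S_n]$ and ${}_S\sigma_n^2=\operatorname{Var}(S_n)$. Let $\gamma$ be the Euler–Mascheroni constant, let $E(x)=\int_x^\infty \frac{e^{-t}}{t}\,dt$ for $x>0$, and for integers $h\ge 2$ put $$G(h)=\frac{1}{(h-1)!}\int_0^\infty x^{h-1}\exp\left[E(x)-x\right]dx .$$ Then $$\lim_{n\to\infty}\frac{{}_S\mu_n}{\ln n}=e^{1-\gamma}.$$ Moreover, for every integer $h\ge 2$ the integral defining $G(h)$ converges and $$\lim_{n\to\infty}\frac{\mathbb{E}[S_n^h]}{n^{h-1}}=e\cdot G(h),$$ and in particular $$\lim_{n\to\infty}\frac{{}_S\sigma_n^2}{n}=e\cdot G(2).$$ -/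

import Mathlib

/-- The length of the shortest cycle of a permutation of `n` symbols. The parts of
`σ.partition` are the lengths of all cycles of `σ`, a fixed point counting as a cycle of
length `1`. (For `n = 0` there is no cycle and the value is `0`.) -/
noncomputable def shortestCycle {n : ℕ} (σ : Equiv.Perm (Fin n)) : ℕ :=
  sInf {k : ℕ | k ∈ σ.partition.parts}

/-- The expectation of `f` under the uniform distribution on the derangements of `n`
symbols. (For `n = 1` there is no derangement and the value is `0`.) -/
noncomputable def derangementMean (n : ℕ) (f : Equiv.Perm (Fin n) → ℝ) : ℝ :=
  (∑ σ : derangements (Fin n), f σ) / (Fintype.card (derangements (Fin n)) : ℝ)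

/-- The `h`-th moment of the shortest cycle length of a random derangement of `n` symbols. -/
noncomputable def shortestCycleMoment (h n : ℕ) : ℝ :=
  derangementMean n fun σ => (shortestCycle σ : ℝ) ^ h

/-- The variance of the shortest cycle length of a random derangement of `n` symbols. -/
noncomputable def shortestCycleVariance (n : ℕ) : ℝ :=
  derangementMean n fun σ => ((shortestCycle σ : ℝ) - shortestCycleMoment 1 n) ^ 2

/-- The exponential integral `E(x) = ∫_x^∞ e^{-t} / t dt`, for `x > 0`. -/
noncomputable def expIntegral (x : ℝ) : ℝ :=
  ∫ t in Set.Ioi x, Real.exp (-t) / t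

/-- The constant `1 / (h-1)! * ∫_0^∞ x^{h-1} exp (E(x) - x) dx`, for `h ≥ 2`. -/
noncomputable def shortestCycleConst (h : ℕ) : ℝ :=
  1 / ((h - 1).factorial : ℝ) *
    ∫ x in Set.Ioi (0 : ℝ), x ^ (h - 1) * Real.exp (expIntegral x - x)

/-! Write p_m(n) for the probability that a uniform permutation of n symbols has no cycle shorter
than m (`longCycleProb`). Derangements are the event S ≥ 2, so summing tails gives E[S_n^h] = (∑_{i
≤ n} (i^h − (i−1)^h) p_i(n) + O(1)) / p_2(n), and p_2(n) → 1/e produces the factor e. Everything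
rests on one recursion, n p_m(n) = ∑_{j ≤ n−m} p_m(j), which comes from removing the cycle through a
given symbol.

For the mean, the recursion bootstraps to |p_m(n+1) − p_m(n)| ≤ 2/(n+1)² for n ≥ m, a bound free of
m, so p_m(n) is within 2/n of its limit once n ≥ m. The generating function exp(−∑_{k<m}
x^k/k)/(1−x) and Abel's theorem identify that limit as exp(−H_{m−1}) ~ e^{−γ}/m. Summing over m ≤ n
costs a total error of at most 2 and leaves e^{−γ} log n.

For h ≥ 2 the terms with m comparable to n dominate. There the recursion becomes Buchstab's
equation: n p_m(n) ≈ V(n/m), where V(u) = u ω(u) = 1 + ∫_1^{u−1} ω for u ≥ 2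
(`exists_abs_mul_longCycleProb_sub_le`). With m = ⌈yn⌉ the tail sum divided by n^{h−1} is exactly an
integral over y in (0, 1], and dominated convergence, using p_m(n) ≤ 1/m, gives the limit h ∫_1^∞
V(u) u^{−h−1} du. The delay equation makes the Laplace transform L of ω satisfy L' = −(e^{−s}/s)(1 +
L), so 1 + L = e^E (`exp_expIntegral`). Integrating s^{h−1} e^{E(s)−s} = s^h ∫_1^∞ V(u) e^{−su} du
over s by Tonelli then identifies the limit with G(h).

The variance follows because the squared mean is O(log² n) = o(n). -/

/-! ### Weights of cycle types and the basic recursion -/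

open Nat in
/-- The reciprocal of the size of the centralizer of a permutation with cycle lengths `s`. -/
noncomputable def cycleWeight (s : Multiset ℕ) : ℝ :=
  ((s.prod * ∏ i ∈ s.toFinset, (s.count i)! : ℕ) : ℝ)⁻¹

open Nat in
theorem prod_count_factorial_cons (i : ℕ) (s : Multiset ℕ) :
    ∏ j ∈ (i ::ₘ s).toFinset, ((i ::ₘ s).count j)! =
      (s.count i + 1) * ∏ j ∈ s.toFinset, (s.count j)! := by
  have hsub : s.toFinset ⊆ (i ::ₘ s).toFinset := by
    intro j hj
    simp only [Multiset.mem_toFinset, Multiset.mem_cons] at *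
    exact Or.inr hj
  have hi : i ∈ (i ::ₘ s).toFinset := by simp
  rw [Finset.prod_subset hsub (f := fun j => (s.count j)!), ← Finset.mul_prod_erase _ _ hi,
    ← Finset.mul_prod_erase _ _ hi, Multiset.count_cons_self, Nat.factorial_succ, mul_assoc]
  · congr 2
    refine Finset.prod_congr rfl fun j hj => ?_
    rw [Multiset.count_cons_of_ne (Finset.ne_of_mem_erase hj)]
  · intro j _ hj
    rw [Multiset.mem_toFinset] at hj
    rw [Multiset.count_eq_zero_of_notMem hj, Nat.factorial_zero]

theorem cycleWeight_zero : cycleWeight 0 = 1 := by simp [cycleWeight]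

theorem cycleWeight_nonneg (s : Multiset ℕ) : 0 ≤ cycleWeight s := by
  unfold cycleWeight; positivity

/-- A further cycle of length i multiplies the order of the centralizer by i times the new
multiplicity of i. -/
theorem count_mul_cycleWeight_cons {i : ℕ} (hi : 0 < i) (s : Multiset ℕ) :
    ((i ::ₘ s).count i * i : ℝ) * cycleWeight (i ::ₘ s) = cycleWeight s := by
  unfold cycleWeight
  rw [prod_count_factorial_cons, Multiset.prod_cons, Multiset.count_cons_self]
  have h1 : (i : ℝ) ≠ 0 := by positivity
  have h2 : ((s.count i : ℝ) + 1) ≠ 0 := by positivity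
  push_cast
  rw [show (i : ℝ) * (s.map fun x : ℕ => (x : ℝ)).prod * (((s.count i : ℝ) + 1) *
    ∏ j ∈ s.toFinset, ((Nat.factorial (s.count j) : ℕ) : ℝ)) = (((s.count i : ℝ) + 1) * i) *
    ((s.map fun x : ℕ => (x : ℝ)).prod * ∏ j ∈ s.toFinset, ((Nat.factorial (s.count j) : ℕ) : ℝ))
      by ring, mul_inv, ← mul_assoc, mul_inv_cancel₀ (mul_ne_zero h2 h1), one_mul]

theorem count_mul_cycleWeight {i : ℕ} (hi : 0 < i) {s : Multiset ℕ} (his : i ∈ s) :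
    (s.count i * i : ℝ) * cycleWeight s = cycleWeight (s.erase i) := by
  obtain ⟨t, rfl⟩ := Multiset.exists_cons_of_mem his
  rw [count_mul_cycleWeight_cons hi, Multiset.erase_cons_head]

/-- The partitions of `n`, as multisets, with all parts at least `m`. -/
noncomputable def partsGE (m n : ℕ) : Finset (Multiset ℕ) :=
  ((Finset.univ : Finset n.Partition).image Nat.Partition.parts).filter fun s => ∀ i ∈ s, m ≤ i

theorem mem_partsGE {m n : ℕ} (hm : 0 < m) {s : Multiset ℕ} :
    s ∈ partsGE m n ↔ s.sum = n ∧ ∀ i ∈ s, m ≤ i := by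
  simp only [partsGE, Finset.mem_filter, Finset.mem_image, Finset.mem_univ, true_and]
  constructor
  · rintro ⟨⟨p, rfl⟩, h⟩
    exact ⟨p.parts_sum, h⟩
  · rintro ⟨h1, h2⟩
    exact ⟨⟨⟨s, fun {i} hi => hm.trans_le (h2 i hi), h1⟩, rfl⟩, h2⟩

/-- The probability that all cycles of a uniform random permutation of `n` symbols have length
at least `m`. -/
noncomputable def longCycleProb (m n : ℕ) : ℝ := ∑ s ∈ partsGE m n, cycleWeight s

theorem longCycleProb_nonneg (m n : ℕ) : 0 ≤ longCycleProb m n :=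
  Finset.sum_nonneg fun s _ => cycleWeight_nonneg s

theorem longCycleProb_zero {m : ℕ} (hm : 0 < m) : longCycleProb m 0 = 1 := by
  have : partsGE m 0 = {0} := by
    ext s
    rw [mem_partsGE hm, Finset.mem_singleton]
    constructor
    · rintro ⟨h1, h2⟩
      refine Multiset.eq_zero_of_forall_notMem fun i hi => ?_
      have := Multiset.le_sum_of_mem hi
      have := h2 i hi
      omega
    · rintro rfl; simp
  rw [longCycleProb, this, Finset.sum_singleton, cycleWeight_zero]

/-- Recursion obtained by removing the cycle through a given symbol. -/
theorem mul_longCycleProb {m : ℕ} (hm : 0 < m) (n : ℕ) :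
    n * longCycleProb m n = ∑ k ∈ Finset.Icc m n, longCycleProb m (n - k) := by
  -- Splitting n as the sum of count · i over the distinct parts i of s turns each weight into
  -- weights of s with one part removed.
  have h1 : n * longCycleProb m n =
      ∑ s ∈ partsGE m n, ∑ i ∈ s.toFinset, cycleWeight (s.erase i) := by
    rw [longCycleProb, Finset.mul_sum]
    refine Finset.sum_congr rfl fun s hs => ?_
    rw [mem_partsGE hm] at hs
    have : (n : ℝ) = ∑ i ∈ s.toFinset, (s.count i * i : ℝ) := by
      rw [← hs.1, Finset.sum_multiset_count]
      push_cast
      simp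
    rw [this, Finset.sum_mul]
    refine Finset.sum_congr rfl fun i hi => ?_
    rw [Multiset.mem_toFinset] at hi
    exact count_mul_cycleWeight (hm.trans_le (hs.2 i hi)) hi
  rw [h1]
  simp only [longCycleProb]
  rw [Finset.sum_sigma', Finset.sum_sigma']
  refine Finset.sum_bij' (fun x _ => ⟨x.2, x.1.erase x.2⟩) (fun y _ => ⟨y.1 ::ₘ y.2, y.1⟩)
    ?_ ?_ ?_ ?_ ?_
  · rintro ⟨s, i⟩ h
    simp only [Finset.mem_sigma, Multiset.mem_toFinset, mem_partsGE hm, Finset.mem_Icc] at h ⊢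
    obtain ⟨⟨h1, h2⟩, h3⟩ := h
    obtain ⟨t, rfl⟩ := Multiset.exists_cons_of_mem h3
    rw [Multiset.erase_cons_head]
    rw [Multiset.sum_cons] at h1
    exact ⟨⟨h2 i h3, by omega⟩, by omega, fun j hj => h2 j (Multiset.mem_cons_of_mem hj)⟩
  · rintro ⟨k, t⟩ h
    simp only [Finset.mem_sigma, Multiset.mem_toFinset, mem_partsGE hm, Finset.mem_Icc] at h ⊢
    obtain ⟨⟨h1, h2⟩, h3, h4⟩ := h
    refine ⟨⟨by rw [Multiset.sum_cons]; omega, fun j hj => ?_⟩, Multiset.mem_cons_self _ _⟩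
    rcases Multiset.mem_cons.1 hj with rfl | hj
    · exact h1
    · exact h4 j hj
  · rintro ⟨s, i⟩ h
    simp only [Finset.mem_sigma, Multiset.mem_toFinset] at h
    simp [Multiset.cons_erase h.2]
  · rintro ⟨k, t⟩ h
    simp
  · rintro ⟨s, i⟩ h
    rfl

/-! ### Counting permutations by cycle lengths -/

/-- `cycleType` omits fixed points; the remaining parts are all 1, and their number is forced by the
total n. -/
theorem Nat.Partition.parts_eq_filter_add_replicate {n : ℕ} (p : n.Partition) :
    p.parts = p.parts.filter (2 ≤ ·) +
      Multiset.replicate (n - (p.parts.filter (2 ≤ ·)).sum) 1 := by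
  have h1 : p.parts.filter (fun i => ¬ 2 ≤ i) =
      Multiset.replicate (Multiset.card (p.parts.filter fun i => ¬ 2 ≤ i)) 1 := by
    rw [Multiset.eq_replicate_card]
    intro i hi
    have := p.parts_pos (Multiset.mem_of_mem_filter hi)
    have := Multiset.of_mem_filter hi
    omega
  have h2 := Multiset.filter_add_not (2 ≤ ·) p.parts
  have h3 := congrArg Multiset.sum h2
  rw [Multiset.sum_add, p.parts_sum, h1, Multiset.sum_replicate, smul_eq_mul, mul_one] at h3
  rw [show n - (p.parts.filter (2 ≤ ·)).sum =
    Multiset.card (p.parts.filter fun i => ¬ 2 ≤ i) by omega, ← h1, h2]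

open Nat in
theorem cycleWeight_add_replicate_one {s : Multiset ℕ} (hs : ∀ i ∈ s, 2 ≤ i) (r : ℕ) :
    cycleWeight (s + Multiset.replicate r 1) =
      ((r ! * s.prod * ∏ i ∈ s.toFinset, (s.count i)! : ℕ) : ℝ)⁻¹ := by
  have key : ∏ i ∈ (s + Multiset.replicate r 1).toFinset,
      ((s + Multiset.replicate r 1).count i)! = r ! * ∏ i ∈ s.toFinset, (s.count i)! := by
    induction r with
    | zero => simp
    | succ r ih =>
      rw [Multiset.replicate_succ, Multiset.add_cons, prod_count_factorial_cons, ih,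
        Multiset.count_add, Multiset.count_replicate_self,
        Multiset.count_eq_zero_of_notMem (fun h => by have := hs 1 h; omega),
        Nat.factorial_succ]
      ring
  rw [cycleWeight, key, Multiset.prod_add, Multiset.prod_replicate, one_pow]
  congr 2
  ring

-- Cauchy's formula: a conjugacy class has n! divided by the order of the centralizer many elements.
open Nat in
theorem card_perm_parts_eq {n : ℕ} (p : n.Partition) :
    ((Finset.univ.filter fun σ : Equiv.Perm (Fin n) => σ.partition.parts = p.parts).card : ℝ) =
      n ! * cycleWeight p.parts := by
  set m := p.parts.filter (2 ≤ ·) with hm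
  have hp : p.parts = m + Multiset.replicate (n - m.sum) 1 := p.parts_eq_filter_add_replicate
  have hm2 : ∀ i ∈ m, 2 ≤ i := fun i hi => Multiset.of_mem_filter hi
  have hsum : m.sum ≤ n := by
    have := congrArg Multiset.sum hp
    rw [p.parts_sum, Multiset.sum_add] at this
    omega
  have hf : (Finset.univ.filter fun σ : Equiv.Perm (Fin n) => σ.partition.parts = p.parts) =
      Finset.univ.filter fun σ : Equiv.Perm (Fin n) => σ.cycleType = m := by
    refine Finset.filter_congr fun σ _ => ⟨fun h => ?_, fun h => ?_⟩
    · rw [hm, ← h, Equiv.Perm.filter_parts_partition_eq_cycleType]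
    · rw [hp, Equiv.Perm.parts_partition, ← Equiv.Perm.sum_cycleType, h, Fintype.card_fin]
  have hc := Equiv.Perm.card_of_cycleType_mul_eq (Fin n) m
  rw [Fintype.card_fin, if_pos ⟨hsum, hm2⟩] at hc
  rw [hf, hp, cycleWeight_add_replicate_one hm2, ← hc, Nat.cast_mul, mul_assoc,
    mul_inv_cancel₀, mul_one]
  have : 0 < m.prod := Multiset.prod_pos fun i hi => by have := hm2 i hi; omega
  positivity

open Nat in
theorem card_perm_forall_le {m n : ℕ} (hm : 0 < m) :
    ((Finset.univ.filter fun σ : Equiv.Perm (Fin n) => ∀ i ∈ σ.partition.parts, m ≤ i).card : ℝ) =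
      n ! * longCycleProb m n := by
  have hmaps : ((Finset.univ.filter fun σ : Equiv.Perm (Fin n) =>
      ∀ i ∈ σ.partition.parts, m ≤ i) : Set (Equiv.Perm (Fin n))).MapsTo
      (fun σ => σ.partition.parts) (partsGE m n) := by
    intro σ hσ
    simp only [Finset.coe_filter, Finset.mem_univ, true_and] at hσ
    rw [Finset.mem_coe, mem_partsGE hm]
    exact ⟨σ.partition.parts_sum.trans (Fintype.card_fin n), hσ⟩
  rw [Finset.card_eq_sum_card_fiberwise hmaps, longCycleProb, Finset.mul_sum, Nat.cast_sum]
  refine Finset.sum_congr rfl fun s hs => ?_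
  rw [mem_partsGE hm] at hs
  let p : n.Partition := ⟨s, fun {i} hi => hm.trans_le (hs.2 i hi), hs.1⟩
  rw [show s = p.parts from rfl, ← card_perm_parts_eq, Finset.filter_filter]
  congr 2
  refine Finset.filter_congr fun σ _ => ⟨fun h => h.2, fun h => ⟨?_, h⟩⟩
  rw [h]
  exact hs.2

theorem partition_parts_ne_zero {n : ℕ} (hn : 0 < n) (σ : Equiv.Perm (Fin n)) :
    σ.partition.parts ≠ 0 := by
  intro h
  have := σ.partition.parts_sum
  rw [h, Fintype.card_fin, Multiset.sum_zero] at this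
  omega

theorem le_shortestCycle_iff {n : ℕ} (hn : 0 < n) (σ : Equiv.Perm (Fin n)) (m : ℕ) :
    m ≤ shortestCycle σ ↔ ∀ i ∈ σ.partition.parts, m ≤ i := by
  have hne : {k : ℕ | k ∈ σ.partition.parts}.Nonempty :=
    Multiset.exists_mem_of_ne_zero (partition_parts_ne_zero hn σ)
  exact ⟨fun h i hi => h.trans (Nat.sInf_le hi), fun h => h _ (Nat.sInf_mem hne)⟩

theorem shortestCycle_le {n : ℕ} (hn : 0 < n) (σ : Equiv.Perm (Fin n)) : shortestCycle σ ≤ n := by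
  obtain ⟨i, hi⟩ := Multiset.exists_mem_of_ne_zero (partition_parts_ne_zero hn σ)
  have h1 := Nat.Partition.le_of_mem_parts hi
  rw [Fintype.card_fin] at h1
  exact ((le_shortestCycle_iff hn σ _).1 le_rfl i hi).trans h1

/-- Positivity of n matters: the empty permutation is a derangement whose `shortestCycle` is 0. -/
theorem mem_derangements_iff_two_le {n : ℕ} (hn : 0 < n) (σ : Equiv.Perm (Fin n)) :
    σ ∈ derangements (Fin n) ↔ 2 ≤ shortestCycle σ := by
  have h1 : σ ∈ derangements (Fin n) ↔ σ.support.card = n := by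
    constructor
    · intro h
      rw [show σ.support = Finset.univ from Finset.eq_univ_of_forall fun x =>
        Equiv.Perm.mem_support.2 (h x), Finset.card_univ, Fintype.card_fin]
    · intro h x
      have : σ.support = Finset.univ := by
        rw [← Finset.card_eq_iff_eq_univ, h, Fintype.card_fin]
      exact Equiv.Perm.mem_support.1 (this ▸ Finset.mem_univ x)
  have hle := σ.support.card_le_univ
  rw [Fintype.card_fin] at hle
  rw [h1, le_shortestCycle_iff hn, Equiv.Perm.parts_partition, Fintype.card_fin]
  constructor
  · intro h i hi
    rw [h, Nat.sub_self, Multiset.replicate_zero, add_zero] at hi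
    exact Equiv.Perm.two_le_of_mem_cycleType hi
  · intro h
    by_contra hne
    have := h 1 (Multiset.mem_add.2 (Or.inr (Multiset.mem_replicate.2 ⟨by omega, rfl⟩)))
    omega

open Nat in
theorem card_perm_le_shortestCycle {m n : ℕ} (hm : 0 < m) (hn : 0 < n) :
    ((Finset.univ.filter fun σ : Equiv.Perm (Fin n) => m ≤ shortestCycle σ).card : ℝ) =
      n ! * longCycleProb m n := by
  rw [← card_perm_forall_le hm]
  congr 2
  exact Finset.filter_congr fun σ _ => le_shortestCycle_iff hn σ m

theorem sum_derangements_eq {n : ℕ} (hn : 0 < n) (f : Equiv.Perm (Fin n) → ℝ) :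
    ∑ σ : derangements (Fin n), f σ =
      ∑ σ ∈ Finset.univ.filter (fun σ : Equiv.Perm (Fin n) => 2 ≤ shortestCycle σ), f σ := by
  refine (Finset.sum_subtype _ (fun σ => ?_) f).symm
  simp [mem_derangements_iff_two_le hn]

open Nat in
theorem card_derangements_eq_mul {n : ℕ} (hn : 0 < n) :
    (Fintype.card (derangements (Fin n)) : ℝ) = n ! * longCycleProb 2 n := by
  have h := sum_derangements_eq hn fun _ => 1
  simp only [Finset.sum_const, nsmul_eq_mul, mul_one, Finset.card_univ] at h
  rw [h, card_perm_le_shortestCycle two_pos hn]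

/-! ### Moments as sums of tail probabilities -/

theorem pow_eq_one_add_sum (h : ℕ) {k n : ℕ} (hk : 1 ≤ k) (hkn : k ≤ n) :
    (k : ℝ) ^ h = 1 + ∑ i ∈ Finset.Icc 2 n,
      if i ≤ k then ((i : ℝ) ^ h - ((i : ℝ) - 1) ^ h) else 0 := by
  rw [← Finset.sum_filter]
  have : (Finset.Icc 2 n).filter (· ≤ k) = Finset.Icc 2 k := by
    ext i; simp only [Finset.mem_filter, Finset.mem_Icc]; omega
  rw [this]
  clear this hkn
  induction k, hk using Nat.le_induction with
  | base => simp
  | succ k hk ih =>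
    rw [Finset.sum_Icc_succ_top (by omega), ← add_assoc, ← ih]
    push_cast
    ring

/-- The telescoped power is averaged over S ≥ 2 and the sums are exchanged. The constant 1
contributes the whole mass of S ≥ 2, and the tail i ≥ 2 already implies being a derangement. -/
theorem shortestCycleMoment_eq (h : ℕ) {n : ℕ} (hn : 0 < n) :
    shortestCycleMoment h n = (longCycleProb 2 n + ∑ i ∈ Finset.Icc 2 n,
      ((i : ℝ) ^ h - ((i : ℝ) - 1) ^ h) * longCycleProb i n) / longCycleProb 2 n := by
  have hfac : ((n.factorial : ℕ) : ℝ) ≠ 0 := by positivity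
  rw [shortestCycleMoment, derangementMean, card_derangements_eq_mul hn,
    sum_derangements_eq hn fun σ => (shortestCycle σ : ℝ) ^ h, ← mul_div_mul_left _ (longCycleProb 2 n) hfac]
  congr 1
  have hpow : ∀ σ ∈ Finset.univ.filter (fun σ : Equiv.Perm (Fin n) => 2 ≤ shortestCycle σ),
      (shortestCycle σ : ℝ) ^ h = 1 + ∑ i ∈ Finset.Icc 2 n,
        if i ≤ shortestCycle σ then ((i : ℝ) ^ h - ((i : ℝ) - 1) ^ h) else 0 :=
    fun σ hσ => pow_eq_one_add_sum h
      (one_le_two.trans (Finset.mem_filter.1 hσ).2) (shortestCycle_le hn σ)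
  rw [Finset.sum_congr rfl hpow, Finset.sum_add_distrib, Finset.sum_const, nsmul_eq_mul, mul_one,
    card_perm_le_shortestCycle two_pos hn, mul_add, Finset.sum_comm, Finset.mul_sum]
  congr 1
  refine Finset.sum_congr rfl fun i hi => ?_
  rw [Finset.mem_Icc] at hi
  rw [← Finset.sum_filter, Finset.filter_filter, Finset.sum_const, nsmul_eq_mul,
    mul_left_comm, mul_comm, ← card_perm_le_shortestCycle (by omega) hn]
  congr 3
  exact Finset.filter_congr fun σ _ => ⟨fun h => h.2, fun h => ⟨hi.1.trans h, h⟩⟩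

/-! ### Estimates uniform in the minimal cycle length -/

open Filter Topology MeasureTheory

theorem mul_longCycleProb_eq_sum_range {m : ℕ} (hm : 0 < m) (n : ℕ) :
    n * longCycleProb m n = ∑ j ∈ Finset.range (n + 1 - m), longCycleProb m j := by
  rw [mul_longCycleProb hm]
  refine Finset.sum_nbij' (fun k => n - k) (fun j => n - j) ?_ ?_ ?_ ?_ ?_ <;>
    simp only [Finset.mem_Icc, Finset.mem_range] <;> intros <;> first | omega | trivial

theorem succ_mul_longCycleProb_succ {m n : ℕ} (hm : 0 < m) (hmn : m ≤ n + 1) :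
    ((n : ℝ) + 1) * longCycleProb m (n + 1) =
      n * longCycleProb m n + longCycleProb m (n + 1 - m) := by
  have h1 := mul_longCycleProb_eq_sum_range hm (n + 1)
  rw [show n + 1 + 1 - m = (n + 1 - m) + 1 by omega, Finset.sum_range_succ,
    ← mul_longCycleProb_eq_sum_range hm n] at h1
  exact_mod_cast h1

theorem longCycleProb_of_lt {m n : ℕ} (hn : 0 < n) (hnm : n < m) : longCycleProb m n = 0 := by
  have h1 := mul_longCycleProb_eq_sum_range (by omega : 0 < m) n
  rw [show n + 1 - m = 0 by omega, Finset.sum_range_zero] at h1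
  have : (n : ℝ) ≠ 0 := by positivity
  exact (mul_eq_zero.1 h1).resolve_left this

/-- Strong induction in the recursion: the term j = 0 equals 1 and the n − m others are at most 1/m,
so the sum is at most 1 + (n − m)/m = n/m. -/
theorem longCycleProb_le {m : ℕ} (hm : 0 < m) {n : ℕ} (hn : 0 < n) :
    longCycleProb m n ≤ 1 / m := by
  have hmR : (0 : ℝ) < m := by positivity
  induction n using Nat.strong_induction_on with
  | _ n ih =>
    rcases lt_or_ge n m with h | h
    · rw [longCycleProb_of_lt hn h]; positivity
    · have h1 := mul_longCycleProb_eq_sum_range hm n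
      rw [show n + 1 - m = (n - m) + 1 by omega, Finset.sum_range_succ', longCycleProb_zero hm] at h1
      have h2 : ∑ k ∈ Finset.range (n - m), longCycleProb m (k + 1) ≤
          ∑ _k ∈ Finset.range (n - m), (1 / m : ℝ) := by
        refine Finset.sum_le_sum fun k hk => ih _ ?_ (by omega)
        rw [Finset.mem_range] at hk
        omega
      rw [Finset.sum_const, Finset.card_range, nsmul_eq_mul, Nat.cast_sub h] at h2
      have hnR : (0 : ℝ) < n := by positivity
      refine le_of_mul_le_mul_left (a := (n : ℝ)) ?_ hnR
      rw [h1]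
      have : ((n : ℝ) - m) * (1 / m) + 1 = n * (1 / m) := by field_simp; ring
      linarith

/-- Subtracting consecutive recursions writes (n + 1) times the increment as a difference of two
numbers in [0, 1/m]; m ≤ n keeps the index n + 1 − m positive. -/
theorem abs_longCycleProb_succ_sub_le {m n : ℕ} (hm : 0 < m) (hmn : m ≤ n) :
    |longCycleProb m (n + 1) - longCycleProb m n| ≤ 1 / (m * (n + 1)) := by
  have h1 := succ_mul_longCycleProb_succ hm (by omega : m ≤ n + 1)
  have h2 : ((n : ℝ) + 1) * (longCycleProb m (n + 1) - longCycleProb m n) =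
      longCycleProb m (n + 1 - m) - longCycleProb m n := by linarith
  have hn1 : (0 : ℝ) < n + 1 := by positivity
  have hmR : (0 : ℝ) < m := by positivity
  have h3 : longCycleProb m (n + 1) - longCycleProb m n =
      (longCycleProb m (n + 1 - m) - longCycleProb m n) / (n + 1) := by
    rw [← h2]; field_simp
  rw [h3, abs_div, abs_of_pos hn1, ← div_div]
  refine div_le_div_of_nonneg_right ?_ hn1.le
  have b1 := longCycleProb_le hm (show 0 < n + 1 - m by omega)
  have b2 := longCycleProb_le hm (show 0 < n by omega)
  have b3 := longCycleProb_nonneg m (n + 1 - m)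
  have b4 := longCycleProb_nonneg m n
  rw [abs_le]
  constructor <;> linarith

theorem abs_sub_le_of_forall_abs_succ_sub_le {a : ℕ → ℝ} {B : ℝ} (p q : ℕ)
    (h : ∀ i, p ≤ i → i < p + q → |a (i + 1) - a i| ≤ B) : |a (p + q) - a p| ≤ q * B := by
  induction q with
  | zero => simp
  | succ q ih =>
    have h1 := ih fun i hi hi' => h i hi (by omega)
    have h2 := h (p + q) (by omega) (by omega)
    have h3 := abs_sub_le (a (p + (q + 1))) (a (p + q)) (a p)
    rw [← add_assoc] at h3 ⊢
    push_cast
    linarith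

/-- For n + 1 ≤ 2m the previous bound suffices. Otherwise it is fed back into the differenced
recursion: the m − 1 steps from n + 1 − m to n each cost at most 2/(m(n + 1)), since every i there
has i + 1 ≥ (n + 1)/2. The factor m cancels. -/
theorem abs_longCycleProb_succ_sub_le_sq {m n : ℕ} (hm : 0 < m) (hmn : m ≤ n) :
    |longCycleProb m (n + 1) - longCycleProb m n| ≤ 2 / ((n : ℝ) + 1) ^ 2 := by
  have hn1 : (0 : ℝ) < n + 1 := by positivity
  have hmR : (0 : ℝ) < m := by positivity
  rcases le_or_gt (n + 1) (2 * m) with h | h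
  · refine (abs_longCycleProb_succ_sub_le hm hmn).trans ?_
    have h' : (n : ℝ) + 1 ≤ 2 * m := by exact_mod_cast h
    rw [div_le_div_iff₀ (by positivity) (by positivity)]
    nlinarith
  · have h1 := succ_mul_longCycleProb_succ hm (by omega : m ≤ n + 1)
    have h2 : ((n : ℝ) + 1) * (longCycleProb m (n + 1) - longCycleProb m n) =
        -(longCycleProb m n - longCycleProb m (n + 1 - m)) := by linarith
    have h3 : |longCycleProb m (n + 1) - longCycleProb m n| =
        |longCycleProb m n - longCycleProb m (n + 1 - m)| / (n + 1) := by
      rw [eq_div_iff hn1.ne', ← abs_neg (longCycleProb m n - _), ← h2, abs_mul,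
        abs_of_pos hn1, mul_comm]
    have h4 := abs_sub_le_of_forall_abs_succ_sub_le (a := longCycleProb m)
      (B := 2 / (m * (n + 1))) (n + 1 - m) (m - 1) fun i hi hi' => by
        refine (abs_longCycleProb_succ_sub_le hm (by omega)).trans ?_
        rw [div_le_div_iff₀ (by positivity) (by positivity)]
        have : (n : ℝ) + 1 ≤ 2 * (i + 1) := by
          have : n + 1 ≤ 2 * (i + 1) := by omega
          exact_mod_cast this
        nlinarith
    rw [show n + 1 - m + (m - 1) = n by omega] at h4
    rw [h3, sq, ← div_div]
    refine div_le_div_of_nonneg_right (h4.trans ?_) hn1.le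
    have h5 : ((m - 1 : ℕ) : ℝ) ≤ m := by exact_mod_cast Nat.sub_le m 1
    calc ((m - 1 : ℕ) : ℝ) * (2 / (m * (n + 1))) ≤ m * (2 / (m * (n + 1))) := by gcongr
      _ = 2 / (n + 1) := by field_simp

theorem abs_longCycleProb_sub_le {m n : ℕ} (hm : 0 < m) (hmn : m ≤ n) (q : ℕ) :
    |longCycleProb m (n + q) - longCycleProb m n| ≤ 2 / n - 2 / ((n + q : ℕ) : ℝ) := by
  have hn : (0 : ℝ) < n := by have : 0 < n := by omega
                              positivity
  induction q with
  | zero => simp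
  | succ q ih =>
    have h2 := abs_longCycleProb_succ_sub_le_sq hm (show m ≤ n + q by omega)
    have h3 := abs_sub_le (longCycleProb m (n + (q + 1))) (longCycleProb m (n + q))
      (longCycleProb m n)
    rw [← add_assoc] at h3 ⊢
    have hN : (0 : ℝ) < ((n + q : ℕ) : ℝ) := by push_cast; positivity
    -- 1/(N + 1)² ≤ 1/N − 1/(N + 1), so the increments telescope.
    have h4 : 2 / (((n + q : ℕ) : ℝ) + 1) ^ 2 ≤
        2 / ((n + q : ℕ) : ℝ) - 2 / ((n + q + 1 : ℕ) : ℝ) := by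
      rw [Nat.cast_succ (n + q), div_sub_div _ _ hN.ne' (by positivity),
        div_le_div_iff₀ (by positivity) (by positivity)]
      nlinarith
    linarith

theorem abs_longCycleProb_le_one {m : ℕ} (hm : 0 < m) (n : ℕ) : |longCycleProb m n| ≤ 1 := by
  rw [abs_of_nonneg (longCycleProb_nonneg m n)]
  rcases Nat.eq_zero_or_pos n with rfl | hn
  · rw [longCycleProb_zero hm]
  · refine (longCycleProb_le hm hn).trans ?_
    rw [div_le_one (by positivity)]
    exact_mod_cast hm

theorem exists_tendsto_longCycleProb {m : ℕ} (hm : 0 < m) :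
    ∃ l, Tendsto (longCycleProb m) atTop (𝓝 l) := by
  refine cauchySeq_tendsto_of_complete ?_
  -- The increment bound is available only from index m on; the summand 4 covers smaller indices by
  -- the trivial bound |p| ≤ 1.
  refine cauchySeq_of_le_tendsto_0 (fun n : ℕ => 2 * (2 / (n : ℝ)) + if n < m then 2 * 2 else 0)
    ?_ ?_
  · intro p q N hp hq
    rw [Real.dist_eq]
    split_ifs with hN
    · have hp1 := abs_le.1 (abs_longCycleProb_le_one hm p)
      have hq1 := abs_le.1 (abs_longCycleProb_le_one hm q)
      have hpos : (0 : ℝ) ≤ 2 * (2 / (N : ℝ)) := by positivity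
      rw [abs_le]
      constructor <;> linarith [hp1.1, hp1.2, hq1.1, hq1.2]
    · have key : ∀ p, N ≤ p → |longCycleProb m p - longCycleProb m N| ≤ 2 / (N : ℝ) :=
        fun p hp => by
          obtain ⟨r, rfl⟩ := Nat.exists_eq_add_of_le hp
          have := abs_longCycleProb_sub_le hm (not_lt.1 hN) r
          have h0 : (0 : ℝ) ≤ 2 / ((N + r : ℕ) : ℝ) := by positivity
          linarith
      have h1 := key p hp
      have h2 := key q hq
      rw [abs_sub_comm] at h2
      linarith [abs_sub_le (longCycleProb m p) (longCycleProb m N) (longCycleProb m q)]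
  · have h1 : Tendsto (fun n : ℕ => 2 * (2 / (n : ℝ))) atTop (𝓝 (2 * 0)) :=
      (tendsto_const_div_atTop_nhds_zero_nat 2).const_mul 2
    have h2 : Tendsto (fun n : ℕ => if n < m then (2 * 2 : ℝ) else 0) atTop (𝓝 0) := by
      refine tendsto_const_nhds.congr' ?_
      filter_upwards [eventually_ge_atTop m] with n hn
      rw [if_neg (by omega)]
    simpa using h1.add h2

/-! ### Generating function and the limit for a fixed minimal length -/

theorem summable_longCycleProb_mul_pow {m : ℕ} (hm : 0 < m) {x : ℝ} (hx : |x| < 1) :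
    Summable fun n => longCycleProb m n * x ^ n := by
  refine Summable.of_norm_bounded (g := fun n : ℕ => |x| ^ n)
    (summable_geometric_of_lt_one (abs_nonneg x) hx) fun n => ?_
  rw [Real.norm_eq_abs, abs_mul, abs_pow]
  exact mul_le_of_le_one_left (by positivity) (abs_longCycleProb_le_one hm n)

/-- The generating function `∑ n, longCycleProb m n * x ^ n`. -/
noncomputable def longCycleGF (m : ℕ) (x : ℝ) : ℝ := ∑' n, longCycleProb m n * x ^ n

theorem hasDerivAt_longCycleGF {m : ℕ} (hm : 0 < m) {x : ℝ} (hx : |x| < 1) :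
    HasDerivAt (longCycleGF m) (∑' n, longCycleProb m n * (n * x ^ (n - 1))) x := by
  obtain ⟨r, hxr, hr⟩ := exists_between hx
  have hr0 : 0 ≤ r := (abs_nonneg x).trans hxr.le
  have hu : Summable fun n : ℕ => (n : ℝ) * r ^ (n - 1) := by
    refine (summable_nat_add_iff 1).1 ?_
    have h1 := summable_pow_mul_geometric_of_norm_lt_one (R := ℝ) 1
      (r := r) (by rwa [Real.norm_eq_abs, abs_of_nonneg hr0])
    have h2 := summable_geometric_of_lt_one hr0 hr
    refine (h1.add h2).congr fun n => ?_
    simp; ring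
  refine hasDerivAt_tsum_of_isPreconnected (t := Set.Ioo (-r) r) (y₀ := 0) hu isOpen_Ioo
    isPreconnected_Ioo (fun n y _ => (hasDerivAt_pow n y).const_mul _) (fun n y hy => ?_)
    ?_ ?_ (abs_lt.1 hxr)
  · rw [Real.norm_eq_abs, abs_mul, abs_mul, abs_pow, Nat.abs_cast]
    have hy' : |y| ≤ r := (abs_lt.2 hy).le
    calc |longCycleProb m n| * (n * |y| ^ (n - 1)) ≤ 1 * (n * r ^ (n - 1)) := by
          gcongr
          exact abs_longCycleProb_le_one hm n
      _ = _ := one_mul _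
  · have : 0 < r := (abs_nonneg x).trans_lt hxr
    constructor <;> linarith
  · exact summable_longCycleProb_mul_pow hm (by simp)

/-- The differenced recursion, read coefficientwise, is the differential equation (1 − x)A' = x^m A.
-/
theorem one_sub_mul_deriv_longCycleGF (m : ℕ) {x : ℝ} (hx : |x| < 1) :
    (1 - x) * ∑' n, longCycleProb (m + 1) n * (n * x ^ (n - 1)) =
      x ^ m * longCycleGF (m + 1) x := by
  have hm : 0 < m + 1 := m.succ_pos
  set a := longCycleProb (m + 1) with ha
  have hs1 : Summable fun n : ℕ => a n * (n * x ^ (n - 1)) := by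
    refine (summable_nat_add_iff 1).1 ?_
    have h1 := summable_pow_mul_geometric_of_norm_lt_one (R := ℝ) 1
      (r := |x|) (by rwa [Real.norm_eq_abs, abs_abs])
    have h2 := summable_geometric_of_lt_one (abs_nonneg x) hx
    refine Summable.of_norm_bounded (h1.add h2) fun n => ?_
    rw [Real.norm_eq_abs, abs_mul, abs_mul, abs_pow, Nat.abs_cast, Nat.add_sub_cancel]
    have := mul_le_of_le_one_left (b := ((n + 1 : ℕ) : ℝ) * |x| ^ n) (by positivity)
      (abs_longCycleProb_le_one hm (n + 1))
    refine this.trans (le_of_eq ?_)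
    push_cast; ring
  have e1 : ∑' n, a n * (n * x ^ (n - 1)) = ∑' n, a (n + 1) * (((n + 1 : ℕ) : ℝ) * x ^ n) := by
    rw [hs1.tsum_eq_zero_add]; simp
  have hs2 : Summable fun n => a (n + 1) * (((n + 1 : ℕ) : ℝ) * x ^ n) := by
    have := (summable_nat_add_iff 1).2 hs1
    simpa using this
  have e2 : x * ∑' n, a n * (n * x ^ (n - 1)) = ∑' n, a n * (n * x ^ n) := by
    rw [← tsum_mul_left]
    refine tsum_congr fun n => ?_
    rcases n with _ | n
    · simp
    · rw [Nat.add_sub_cancel]; ring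
  have hs3 : Summable fun n : ℕ => a n * (n * x ^ n) := by
    refine (hs1.mul_left x).congr fun n => ?_
    rcases n with _ | n
    · simp
    · rw [Nat.add_sub_cancel]; ring
  rw [sub_mul, one_mul, e2, e1, ← hs2.tsum_sub hs3]
  have key : ∀ n, a (n + 1) * (((n + 1 : ℕ) : ℝ) * x ^ n) - a n * (n * x ^ n) =
      if n < m then 0 else a (n - m) * x ^ n := by
    intro n
    split_ifs with h
    · have h1 : a (n + 1) = 0 := longCycleProb_of_lt n.succ_pos (by omega)
      rcases Nat.eq_zero_or_pos n with rfl | hn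
      · rw [h1]; simp
      · rw [h1, show a n = 0 from longCycleProb_of_lt hn (by omega)]; simp
    · have := succ_mul_longCycleProb_succ hm (show m + 1 ≤ n + 1 by omega)
      rw [Nat.add_sub_add_right] at this
      push_cast
      linear_combination x ^ n * this
  simp_rw [key]
  have hs4 := (hs2.sub hs3).congr key
  rw [← hs4.sum_add_tsum_nat_add m, Finset.sum_eq_zero, zero_add, longCycleGF, ← tsum_mul_left]
  · refine tsum_congr fun n => ?_
    rw [if_neg (by omega), Nat.add_sub_cancel, pow_add]; ring
  · intro n hn
    rw [if_pos (Finset.mem_range.1 hn)]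

/-- The differential equation and the geometric sum show that (1 − x) A(x) exp(∑ x^k/k) has zero
derivative, and its value at 0 is 1. -/
theorem longCycleGF_eq (m : ℕ) {x : ℝ} (hx : |x| < 1) :
    (1 - x) * longCycleGF (m + 1) x =
      Real.exp (-∑ k ∈ Finset.range m, x ^ (k + 1) / (k + 1)) := by
  set P : ℝ → ℝ := fun x => ∑ k ∈ Finset.range m, x ^ (k + 1) / (k + 1) with hP
  have hPd : ∀ y, HasDerivAt P (∑ k ∈ Finset.range m, y ^ k) y := by
    intro y
    refine HasDerivAt.fun_sum fun k _ => ?_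
    have := (hasDerivAt_pow (k + 1) y).div_const ((k : ℝ) + 1)
    refine this.congr_deriv ?_
    rw [Nat.add_sub_cancel]
    push_cast
    field_simp
  have hd : ∀ y ∈ Set.Ioo (-1 : ℝ) 1, HasDerivAt
      (fun y => ((1 - y) * longCycleGF (m + 1) y) * Real.exp (P y)) 0 y := by
    intro y hy
    have hy' : |y| < 1 := abs_lt.2 hy
    have h1 := (((hasDerivAt_id y).const_sub 1).mul
      (hasDerivAt_longCycleGF m.succ_pos hy')).mul (hPd y).exp
    refine h1.congr_deriv ?_
    have h2 := one_sub_mul_deriv_longCycleGF m hy'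
    have h3 := mul_neg_geom_sum y m
    simp only [id, Pi.mul_apply] at *
    rw [h2]
    linear_combination longCycleGF (m + 1) y * Real.exp (P y) * h3
  have hconst := isOpen_Ioo.is_const_of_deriv_eq_zero isPreconnected_Ioo
    (fun y hy => (hd y hy).differentiableAt.differentiableWithinAt)
    (fun y hy => (hd y hy).deriv) (abs_lt.1 hx) (show (0 : ℝ) ∈ Set.Ioo (-1 : ℝ) 1 by norm_num)
  have h0 : longCycleGF (m + 1) 0 = 1 := by
    rw [longCycleGF, tsum_eq_single 0 fun n hn => by simp [hn], longCycleProb_zero m.succ_pos]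
    simp
  have hP0 : P 0 = 0 := by simp [hP]
  simp only [h0, hP0, sub_zero, mul_one, Real.exp_zero] at hconst
  rw [Real.exp_neg]
  exact eq_inv_of_mul_eq_one_left hconst

/-- Convergence is already known, so Abel's theorem, applied to the successive differences `f` whose
power series is (1 − x)A(x), suffices and no Tauberian argument is needed. -/
theorem tendsto_longCycleProb (m : ℕ) :
    Tendsto (longCycleProb (m + 1)) atTop (𝓝 (Real.exp (-(harmonic m : ℝ)))) := by
  obtain ⟨l, hl⟩ := exists_tendsto_longCycleProb m.succ_pos
  set a := longCycleProb (m + 1) with ha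
  let f : ℕ → ℝ := fun n => a n - if n = 0 then 0 else a (n - 1)
  have hf : ∀ n, ∑ i ∈ Finset.range (n + 1), f i = a n := by
    intro n
    induction n with
    | zero => simp [f]
    | succ n ih => rw [Finset.sum_range_succ, ih]; simp [f]
  have hfl : Tendsto (fun n => ∑ i ∈ Finset.range n, f i) atTop (𝓝 l) := by
    refine (tendsto_add_atTop_iff_nat 1).1 ?_
    simpa only [hf] using hl
  have h1 := Real.tendsto_tsum_powerSeries_nhdsWithin_lt hfl
  have h2 : ∀ x : ℝ, |x| < 1 → ∑' n, f n * x ^ n = (1 - x) * longCycleGF (m + 1) x := by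
    intro x hx
    have hs := summable_longCycleProb_mul_pow m.succ_pos hx
    have hs' : Summable fun n => (if n = 0 then 0 else a (n - 1)) * x ^ n := by
      refine (summable_nat_add_iff 1).1 ((hs.mul_left x).congr fun n => ?_)
      simp [pow_succ]; ring
    simp only [f, sub_mul]
    rw [hs.tsum_sub hs', hs'.tsum_eq_zero_add, longCycleGF, one_mul, ← tsum_mul_left]
    congr 1
    simp only [if_true, zero_mul, zero_add]
    refine tsum_congr fun n => ?_
    simp [pow_succ]; ring
  have h3 : Tendsto (fun x : ℝ => Real.exp (-∑ k ∈ Finset.range m, x ^ (k + 1) / (k + 1)))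
      (𝓝[<] 1) (𝓝 (Real.exp (-(harmonic m : ℝ)))) := by
    have hc : Continuous fun x : ℝ =>
        Real.exp (-∑ k ∈ Finset.range m, x ^ (k + 1) / ((k : ℝ) + 1)) := by fun_prop
    have := (hc.tendsto 1).mono_left (nhdsWithin_le_nhds (s := Set.Iio 1))
    simpa [harmonic] using this
  have h4 : (fun x : ℝ => ∑' n, f n * x ^ n) =ᶠ[𝓝[<] 1]
      fun x => Real.exp (-∑ k ∈ Finset.range m, x ^ (k + 1) / (k + 1)) := by
    filter_upwards [Ioo_mem_nhdsLT (show (0 : ℝ) < 1 by norm_num)] with x hx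
    have hx' : |x| < 1 := abs_lt.2 ⟨by linarith [hx.1], hx.2⟩
    rw [h2 x hx', longCycleGF_eq m hx']
  rwa [tendsto_nhds_unique (h1.congr' h4) h3] at hl

theorem abs_longCycleProb_sub_exp_le {m n : ℕ} (hmn : m + 1 ≤ n) :
    |longCycleProb (m + 1) n - Real.exp (-(harmonic m : ℝ))| ≤ 2 / n := by
  have h1 : Tendsto (fun q => |longCycleProb (m + 1) (q + n) - longCycleProb (m + 1) n|) atTop
      (𝓝 |Real.exp (-(harmonic m : ℝ)) - longCycleProb (m + 1) n|) :=
    (((tendsto_add_atTop_iff_nat n).2 (tendsto_longCycleProb m)).sub_const _).abs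
  rw [abs_sub_comm]
  refine le_of_tendsto h1 (Eventually.of_forall fun q => ?_)
  have := abs_longCycleProb_sub_le m.succ_pos hmn q
  rw [add_comm q n]
  have h0 : (0 : ℝ) ≤ 2 / ((n + q : ℕ) : ℝ) := by positivity
  linarith

/-! ### Harmonic sums and the logarithmic growth of the mean -/

theorem tendsto_harmonic_atTop : Tendsto (fun n => (harmonic n : ℝ)) atTop atTop := by
  refine tendsto_atTop_mono (fun n => log_add_one_le_harmonic n) ?_
  exact Real.tendsto_log_atTop.comp
    ((tendsto_natCast_atTop_atTop (R := ℝ)).comp (tendsto_add_atTop_nat 1))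

theorem tendsto_harmonic_div_log :
    Tendsto (fun n : ℕ => (harmonic n : ℝ) / Real.log n) atTop (𝓝 1) := by
  have hlog : Tendsto (fun n : ℕ => Real.log n) atTop atTop :=
    Real.tendsto_log_atTop.comp tendsto_natCast_atTop_atTop
  have h1 := (Real.tendsto_harmonic_sub_log.div_atTop hlog).add_const 1
  rw [zero_add] at h1
  refine h1.congr' ?_
  filter_upwards [hlog.eventually_gt_atTop 0] with n hn
  field_simp
  ring

theorem exp_neg_harmonic (k : ℕ) :
    Real.exp (-(harmonic k : ℝ)) = Real.exp (-Real.eulerMascheroniSeq k) / (k + 1) := by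
  have hk : (0 : ℝ) < k + 1 := by positivity
  rw [Real.eulerMascheroniSeq, neg_sub, Real.exp_sub, Real.exp_log hk, Real.exp_neg]
  field_simp

/-- The terms are asymptotic to e^{−γ}/(k + 1), and a little-o relation passes to partial sums
because the harmonic series diverges. -/
theorem tendsto_sum_exp_neg_harmonic_div_harmonic :
    Tendsto (fun n => (∑ k ∈ Finset.range n, Real.exp (-(harmonic k : ℝ))) / (harmonic n : ℝ)) atTop
      (𝓝 (Real.exp (-Real.eulerMascheroniConstant))) := by
  set c := Real.exp (-Real.eulerMascheroniConstant) with hc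
  have hharm : ∀ n, ∑ k ∈ Finset.range n, (1 / ((k : ℝ) + 1)) = (harmonic n : ℝ) := by
    intro n
    simp [harmonic]
  have h1 : Tendsto (fun k => Real.exp (-Real.eulerMascheroniSeq k) - c) atTop (𝓝 0) := by
    have := (Real.continuous_exp.tendsto _).comp Real.tendsto_eulerMascheroniSeq.neg
    simpa [hc] using this.sub_const c
  have h2 : (fun k : ℕ => (Real.exp (-Real.eulerMascheroniSeq k) - c) * (1 / ((k : ℝ) + 1)))
      =o[atTop] fun k : ℕ => 1 / ((k : ℝ) + 1) := by
    have := ((Asymptotics.isLittleO_one_iff ℝ).2 h1).mul_isBigO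
      (Asymptotics.isBigO_refl (fun k : ℕ => 1 / ((k : ℝ) + 1)) atTop)
    simpa using this
  have h3 := h2.sum_range (fun k => by positivity) (by simpa only [hharm] using tendsto_harmonic_atTop)
  simp only [hharm] at h3
  have h4 := h3.tendsto_div_nhds_zero.add_const c
  rw [zero_add] at h4
  refine h4.congr' ?_
  filter_upwards [tendsto_harmonic_atTop.eventually_gt_atTop 0] with n hn
  have : ∑ k ∈ Finset.range n, (Real.exp (-Real.eulerMascheroniSeq k) - c) * (1 / ((k : ℝ) + 1)) =
      (∑ k ∈ Finset.range n, Real.exp (-(harmonic k : ℝ))) - c * (harmonic n : ℝ) := by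
    rw [← hharm, Finset.mul_sum, ← Finset.sum_sub_distrib]
    refine Finset.sum_congr rfl fun k _ => ?_
    rw [exp_neg_harmonic]; ring
  rw [this, sub_div, mul_div_cancel_right₀ _ hn.ne', sub_add_cancel]

theorem tendsto_sum_longCycleProb_div_log :
    Tendsto (fun n : ℕ => (∑ k ∈ Finset.range n, longCycleProb (k + 1) n) / Real.log n) atTop
      (𝓝 (Real.exp (-Real.eulerMascheroniConstant))) := by
  have hlog : Tendsto (fun n : ℕ => Real.log n) atTop atTop :=
    Real.tendsto_log_atTop.comp tendsto_natCast_atTop_atTop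
  have h1 := tendsto_sum_exp_neg_harmonic_div_harmonic.mul tendsto_harmonic_div_log
  rw [mul_one] at h1
  have h2 : Tendsto (fun n : ℕ => ((∑ k ∈ Finset.range n, longCycleProb (k + 1) n) -
      ∑ k ∈ Finset.range n, Real.exp (-(harmonic k : ℝ))) / Real.log n) atTop (𝓝 0) := by
    refine squeeze_zero_norm' (a := fun n : ℕ => 2 / Real.log n) ?_
      (tendsto_const_nhds.div_atTop hlog)
    filter_upwards [eventually_gt_atTop 0, hlog.eventually_gt_atTop 0] with n hn hl
    rw [Real.norm_eq_abs, abs_div, abs_of_pos hl, ← Finset.sum_sub_distrib]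
    refine div_le_div_of_nonneg_right ?_ hl.le
    calc _ ≤ ∑ k ∈ Finset.range n, |longCycleProb (k + 1) n - Real.exp (-(harmonic k : ℝ))| :=
          Finset.abs_sum_le_sum_abs _ _
      _ ≤ ∑ k ∈ Finset.range n, 2 / (n : ℝ) := Finset.sum_le_sum fun k hk =>
          abs_longCycleProb_sub_exp_le (Finset.mem_range.1 hk)
      _ = 2 := by
        have : (n : ℝ) ≠ 0 := by positivity
        simp; field_simp
  have h3 := h2.add h1
  rw [zero_add] at h3
  refine h3.congr' ?_
  filter_upwards [tendsto_harmonic_atTop.eventually_gt_atTop 0, hlog.eventually_gt_atTop 0]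
    with n hn hl
  field_simp
  ring

/-! ### The Buchstab function -/

/-- Picard iterates for the integral equation defining `buchstabV`. -/
noncomputable def buchstabIter : ℕ → ℝ → ℝ
  | 0, _ => 1
  | k + 1, u => 1 + ∫ t in (1 : ℝ)..(max 1 (u - 1)), buchstabIter k t / max 1 t

theorem buchstabIter_succ (k : ℕ) (u : ℝ) : buchstabIter (k + 1) u =
    1 + ∫ t in (1 : ℝ)..(max 1 (u - 1)), buchstabIter k t / max 1 t := rfl

theorem one_le_max_one_left (t : ℝ) : 1 ≤ max 1 t := le_max_left _ _

theorem max_one_pos (t : ℝ) : 0 < max 1 t := one_pos.trans_le (one_le_max_one_left t)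

theorem continuous_div_max_one {f : ℝ → ℝ} (hf : Continuous f) :
    Continuous fun t => f t / max 1 t :=
  hf.div (by fun_prop) fun t => (max_one_pos t).ne'

theorem continuous_buchstabIter (k : ℕ) : Continuous (buchstabIter k) := by
  induction k with
  | zero => exact continuous_const
  | succ k ih =>
    have h := intervalIntegral.continuous_primitive
      (fun a b => (continuous_div_max_one ih).intervalIntegrable (μ := volume) a b) 1
    have h2 : Continuous fun u : ℝ => max 1 (u - 1) := by fun_prop
    exact continuous_const.add (h.comp h2)

theorem buchstabIter_nonneg (k : ℕ) (u : ℝ) : 0 ≤ buchstabIter k u := by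
  induction k generalizing u with
  | zero => exact zero_le_one
  | succ k ih =>
    refine add_nonneg zero_le_one
      (intervalIntegral.integral_nonneg (le_max_left _ _) fun t _ => ?_)
    exact div_nonneg (ih t) (max_one_pos t).le

theorem buchstabIter_le (k : ℕ) (u : ℝ) : buchstabIter k u ≤ max 1 u := by
  induction k generalizing u with
  | zero => exact le_max_left _ _
  | succ k ih =>
    have h1 : ∫ t in (1 : ℝ)..(max 1 (u - 1)), buchstabIter k t / max 1 t ≤
        ∫ _t in (1 : ℝ)..(max 1 (u - 1)), (1 : ℝ) := by
      refine intervalIntegral.integral_mono_on (le_max_left _ _)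
        ((continuous_div_max_one (continuous_buchstabIter k)).intervalIntegrable _ _)
        (continuous_const.intervalIntegrable _ _) fun t _ => ?_
      exact (div_le_one (max_one_pos t)).2 (ih t)
    rw [intervalIntegral.integral_const, smul_eq_mul, mul_one] at h1
    have h2 : max 1 (u - 1) ≤ max 1 u := max_le_max le_rfl (by linarith)
    rw [buchstabIter]
    linarith

/-- The integral sees arguments only up to u − 1 (or 1), so each iteration extends the range of
stability by one unit. -/
theorem buchstabIter_succ_eq (k : ℕ) {u : ℝ} (hu : u ≤ k + 2) :
    buchstabIter (k + 1) u = buchstabIter k u := by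
  induction k generalizing u with
  | zero =>
    rw [buchstabIter_succ, max_eq_left (by push_cast at hu; linarith),
      intervalIntegral.integral_same, add_zero]
    rfl
  | succ k ih =>
    rw [buchstabIter_succ, buchstabIter_succ k]
    congr 1
    refine intervalIntegral.integral_congr fun t ht => ?_
    rw [Set.uIcc_of_le (le_max_left _ _)] at ht
    push_cast at hu
    have hk : (0 : ℝ) ≤ k := Nat.cast_nonneg k
    have : t ≤ k + 2 := ht.2.trans (max_le (by linarith) (by linarith))
    simp only [ih this]

theorem buchstabIter_eq_of_le {k j : ℕ} (hkj : k ≤ j) {u : ℝ} (hu : u ≤ k + 2) :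
    buchstabIter j u = buchstabIter k u := by
  induction j, hkj using Nat.le_induction with
  | base => rfl
  | succ j hj ih =>
    have : (k : ℝ) ≤ j := by exact_mod_cast hj
    rw [buchstabIter_succ_eq j (by linarith), ih]

/-- The function `u * ω(u)`, where `ω` is the Buchstab function, extended by `1` to `u < 1`. -/
noncomputable def buchstabV (u : ℝ) : ℝ := buchstabIter ⌈u⌉₊ u

theorem buchstabV_eq_iter {k : ℕ} {u : ℝ} (hu : u ≤ k + 2) : buchstabV u = buchstabIter k u := by
  rw [buchstabV]
  have h1 := Nat.le_ceil u
  rcases le_total k ⌈u⌉₊ with h | h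
  · exact buchstabIter_eq_of_le h hu
  · exact (buchstabIter_eq_of_le h (by linarith)).symm

theorem buchstabV_nonneg (u : ℝ) : 0 ≤ buchstabV u := buchstabIter_nonneg _ _

theorem buchstabV_le (u : ℝ) : buchstabV u ≤ max 1 u := buchstabIter_le _ _

theorem buchstabV_of_le_two {u : ℝ} (hu : u ≤ 2) : buchstabV u = 1 := by
  rw [buchstabV_eq_iter (k := 0) (by simpa using hu)]; rfl

theorem continuous_buchstabV : Continuous buchstabV := by
  refine continuous_iff_continuousAt.2 fun u => ?_
  refine (continuous_buchstabIter ⌈u⌉₊).continuousAt.congr ?_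
  have h1 := Nat.le_ceil u
  filter_upwards [Iio_mem_nhds (show u < ⌈u⌉₊ + 2 by linarith)] with w hw
  exact (buchstabV_eq_iter (le_of_lt hw)).symm

/-- The Buchstab function `ω(u)` for `1 ≤ u`. -/
noncomputable def buchstab (u : ℝ) : ℝ := buchstabV u / max 1 u

theorem continuous_buchstab : Continuous buchstab := continuous_div_max_one continuous_buchstabV

theorem buchstab_nonneg (u : ℝ) : 0 ≤ buchstab u :=
  div_nonneg (buchstabV_nonneg u) (max_one_pos u).le

theorem buchstab_le_one (u : ℝ) : buchstab u ≤ 1 :=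
  (div_le_one (max_one_pos u)).2 (buchstabV_le u)

theorem buchstabV_eq (u : ℝ) :
    buchstabV u = 1 + ∫ t in (1 : ℝ)..(max 1 (u - 1)), buchstab t := by
  have h1 := Nat.le_ceil u
  rw [buchstabV_eq_iter (k := ⌈u⌉₊ + 1) (by push_cast; linarith), buchstabIter]
  congr 1
  refine intervalIntegral.integral_congr fun t ht => ?_
  rw [Set.uIcc_of_le (le_max_left _ _)] at ht
  have h0 : (0 : ℝ) ≤ ⌈u⌉₊ := Nat.cast_nonneg _
  have : t ≤ ⌈u⌉₊ + 2 := ht.2.trans (max_le (by linarith) (by linarith))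
  simp only [buchstab]
  rw [buchstabV_eq_iter this]

theorem abs_max_one_sub_le (u w : ℝ) : |max 1 u - max 1 w| ≤ |u - w| := by
  have := abs_max_sub_max_le_abs u w 1
  rwa [max_comm u, max_comm w] at this

theorem abs_buchstabV_sub_le (u w : ℝ) : |buchstabV u - buchstabV w| ≤ |u - w| := by
  rw [buchstabV_eq u, buchstabV_eq w, add_sub_add_left_eq_sub,
    intervalIntegral.integral_interval_sub_left
      (continuous_buchstab.intervalIntegrable _ _) (continuous_buchstab.intervalIntegrable _ _)]
  have h1 := intervalIntegral.norm_integral_le_of_norm_le_const (f := buchstab) (C := 1)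
    (a := max 1 (w - 1)) (b := max 1 (u - 1)) fun t _ => by
      rw [Real.norm_eq_abs, abs_of_nonneg (buchstab_nonneg t)]
      exact buchstab_le_one t
  rw [one_mul, Real.norm_eq_abs] at h1
  refine h1.trans ((abs_max_one_sub_le _ _).trans (le_of_eq ?_))
  congr 1; ring

/-- Quotient of two 1-Lipschitz functions with denominator at least 1 and value at most 1; this
controls the Riemann sums below. -/
theorem abs_buchstab_sub_le (u w : ℝ) : |buchstab u - buchstab w| ≤ 2 * |u - w| := by
  have hp := one_le_max_one_left u
  have hp0 := max_one_pos u
  have hq0 := max_one_pos w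
  have e : max 1 u * (buchstab u - buchstab w) =
      (buchstabV u - buchstabV w) - (max 1 u - max 1 w) * buchstab w := by
    simp only [buchstab]
    field_simp
    ring
  have h1 := abs_sub (buchstabV u - buchstabV w) ((max 1 u - max 1 w) * buchstab w)
  rw [← e, abs_mul, abs_mul, abs_of_pos hp0, abs_of_nonneg (buchstab_nonneg w)] at h1
  have h2 := abs_buchstabV_sub_le u w
  have h3 : |max 1 u - max 1 w| * buchstab w ≤ |u - w| * 1 :=
    mul_le_mul (abs_max_one_sub_le u w) (buchstab_le_one w) (buchstab_nonneg w) (abs_nonneg _)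
  have h4 : |buchstab u - buchstab w| ≤ max 1 u * |buchstab u - buchstab w| :=
    le_mul_of_one_le_left (abs_nonneg _) hp
  linarith

/-! ### Approximation of the probabilities by the Buchstab function -/

/-- Indices 0 < j < m contribute nothing, which makes the recursion the discrete form of
`buchstabV_eq`. -/
theorem mul_longCycleProb_eq_one_add {m n : ℕ} (hm : 0 < m) (hmn : m ≤ n) :
    n * longCycleProb m n = 1 + ∑ j ∈ Finset.Ico m (n + 1 - m), longCycleProb m j := by
  rw [mul_longCycleProb_eq_sum_range hm, Finset.range_eq_Ico,
    Finset.sum_eq_sum_Ico_succ_bot (by omega), longCycleProb_zero hm]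
  congr 1
  refine (Finset.sum_subset (Finset.Ico_subset_Ico_left (by omega)) fun j hj hj' => ?_).symm
  rw [Finset.mem_Ico] at hj hj'
  exact longCycleProb_of_lt (by omega) (by omega)

theorem abs_buchstab_div_sub_integral_le {m : ℕ} (hm : 0 < m) (j : ℕ) :
    |buchstab ((j : ℝ) / m) / m - ∫ t in ((j : ℝ) / m)..(((j + 1 : ℕ) : ℝ) / m), buchstab t| ≤
      2 / (m : ℝ) ^ 2 := by
  have hmR : (0 : ℝ) < m := by positivity
  have hlen : ((j + 1 : ℕ) : ℝ) / m - (j : ℝ) / m = 1 / m := by push_cast; field_simp; ring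
  have hle : (j : ℝ) / m ≤ ((j + 1 : ℕ) : ℝ) / m := by
    have : (0 : ℝ) < 1 / m := by positivity
    linarith
  have h1 : buchstab ((j : ℝ) / m) / m =
      ∫ _t in ((j : ℝ) / m)..(((j + 1 : ℕ) : ℝ) / m), buchstab ((j : ℝ) / m) := by
    rw [intervalIntegral.integral_const, hlen, smul_eq_mul]; ring
  rw [h1, ← intervalIntegral.integral_sub (continuous_const.intervalIntegrable _ _)
    (continuous_buchstab.intervalIntegrable _ _)]
  have h2 := intervalIntegral.norm_integral_le_of_norm_le_const
    (f := fun t => buchstab ((j : ℝ) / m) - buchstab t) (C := 2 / m)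
    (a := (j : ℝ) / m) (b := ((j + 1 : ℕ) : ℝ) / m) fun t ht => by
      rw [Set.uIoc_of_le hle] at ht
      rw [Real.norm_eq_abs, abs_sub_comm]
      refine (abs_buchstab_sub_le _ _).trans ?_
      rw [abs_of_nonneg (by linarith [ht.1])]
      have : t - (j : ℝ) / m ≤ 1 / m := by linarith [ht.2]
      calc 2 * (t - (j : ℝ) / m) ≤ 2 * (1 / m) := by gcongr
        _ = 2 / m := by ring
  rw [hlen, abs_of_pos (by positivity), Real.norm_eq_abs] at h2
  refine h2.trans (le_of_eq ?_)
  field_simp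

theorem exists_abs_mul_longCycleProb_sub_le (k : ℕ) :
    ∃ C : ℝ, 0 ≤ C ∧ ∀ m n : ℕ, 0 < m → m ≤ n → n ≤ k * m →
      |n * longCycleProb m n - buchstabV ((n : ℝ) / m)| ≤ C / m := by
  induction k with
  | zero => exact ⟨0, le_rfl, fun m n h1 h2 h3 => by omega⟩
  | succ k ih =>
    obtain ⟨C, hC, ih⟩ := ih
    -- At most km indices j, each with inductive error C/m² and Riemann error 2/m², plus the
    -- unmatched last term j = n − m, which is at most 1/m.
    refine ⟨k * (C + 2) + 1, by positivity, fun m n hm hmn hn => ?_⟩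
    have hmR : (0 : ℝ) < m := by positivity
    rw [mul_longCycleProb_eq_one_add hm hmn]
    rcases lt_or_ge n (2 * m) with h | h
    · have h' : (n : ℝ) ≤ 2 * m := by exact_mod_cast h.le
      rw [Finset.Ico_eq_empty (by omega), Finset.sum_empty, add_zero,
        buchstabV_of_le_two ((div_le_iff₀ hmR).2 h'), sub_self, abs_zero]
      positivity
    · have h' : 2 * (m : ℝ) ≤ n := by exact_mod_cast h
      have hint : ∫ t in (1 : ℝ)..(max 1 ((n : ℝ) / m - 1)), buchstab t =
          ∑ j ∈ Finset.Ico m (n - m),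
            ∫ t in ((j : ℝ) / m)..(((j + 1 : ℕ) : ℝ) / m), buchstab t := by
        rw [intervalIntegral.sum_integral_adjacent_intervals_Ico (a := fun j : ℕ => (j : ℝ) / m)
          (by omega) fun j _ => continuous_buchstab.intervalIntegrable _ _]
        rw [max_eq_right (by rw [le_sub_iff_add_le, le_div_iff₀ hmR]; linarith),
          div_self hmR.ne', Nat.cast_sub hmn, sub_div, div_self hmR.ne']
      rw [buchstabV_eq, hint, show n + 1 - m = (n - m) + 1 by omega,
        Finset.sum_Ico_succ_top (by omega), add_sub_add_left_eq_sub, add_sub_right_comm,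
        ← Finset.sum_sub_distrib]
      have hterm : ∀ j ∈ Finset.Ico m (n - m), |longCycleProb m j -
          ∫ t in ((j : ℝ) / m)..(((j + 1 : ℕ) : ℝ) / m), buchstab t| ≤ (C + 2) / (m : ℝ) ^ 2 := by
        intro j hj
        rw [Finset.mem_Ico] at hj
        have hjR : (m : ℝ) ≤ j := by exact_mod_cast hj.1
        have hj0 : (0 : ℝ) < j := hmR.trans_le hjR
        have h1 := ih m j hm hj.1 (by rw [Nat.add_mul] at hn; omega)
        have e : longCycleProb m j - buchstab ((j : ℝ) / m) / m =
            (j * longCycleProb m j - buchstabV ((j : ℝ) / m)) / j := by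
          rw [buchstab, max_eq_right ((one_le_div hmR).2 hjR)]
          field_simp
        have h2 : |longCycleProb m j - buchstab ((j : ℝ) / m) / m| ≤ C / (m : ℝ) ^ 2 := by
          rw [e, abs_div, abs_of_pos hj0, sq, ← div_div]
          exact div_le_div₀ (by positivity) h1 hmR hjR
        have h3 := abs_buchstab_div_sub_integral_le hm j
        have h4 := abs_sub_le (longCycleProb m j) (buchstab ((j : ℝ) / m) / m)
          (∫ t in ((j : ℝ) / m)..(((j + 1 : ℕ) : ℝ) / m), buchstab t)
        rw [add_div]
        linarith
      have hsum := (Finset.abs_sum_le_sum_abs _ _).trans (Finset.sum_le_sum hterm)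
      rw [Finset.sum_const, nsmul_eq_mul, Nat.card_Ico] at hsum
      have hcard : ((n - m - m : ℕ) : ℝ) ≤ k * m := by
        have : n - m - m ≤ k * m := by rw [Nat.add_mul] at hn; omega
        exact_mod_cast this
      have hlast : |longCycleProb m (n - m)| ≤ 1 / m := by
        rw [abs_of_nonneg (longCycleProb_nonneg _ _)]
        exact longCycleProb_le hm (by omega)
      refine (abs_add_le _ _).trans ?_
      have h5 : ((n - m - m : ℕ) : ℝ) * ((C + 2) / (m : ℝ) ^ 2) ≤
          k * m * ((C + 2) / (m : ℝ) ^ 2) := by gcongr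
      have h6 : k * m * ((C + 2) / (m : ℝ) ^ 2) = k * (C + 2) / m := by field_simp
      rw [add_div]
      linarith

/-! ### Laplace transform of the Buchstab function -/

theorem integrableOn_pow_mul_exp_neg_mul_Ioi (k : ℕ) {s : ℝ} (hs : 0 < s) :
    IntegrableOn (fun x : ℝ => x ^ k * Real.exp (-s * x)) (Set.Ioi 0) := by
  have hk : (-1 : ℝ) < k := by have : (0 : ℝ) ≤ k := Nat.cast_nonneg k
                               linarith
  have := integrableOn_rpow_mul_exp_neg_mul_rpow hk one_pos hs
  simpa only [Real.rpow_one, Real.rpow_natCast] using this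

theorem integral_pow_mul_exp_neg_mul_Ioi (k : ℕ) {s : ℝ} (hs : 0 < s) :
    ∫ x in Set.Ioi (0 : ℝ), x ^ k * Real.exp (-s * x) = k.factorial / s ^ (k + 1) := by
  have := Real.integral_rpow_mul_exp_neg_mul_Ioi (a := k + 1) (by positivity) hs
  rw [add_sub_cancel_right, Real.Gamma_nat_eq_factorial] at this
  simp only [Real.rpow_natCast, ← neg_mul] at this
  rw [this, show (k : ℝ) + 1 = ((k + 1 : ℕ) : ℝ) by push_cast; ring, Real.rpow_natCast]
  rw [one_div, inv_pow]
  ring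

theorem integrableOn_mul_exp_neg_mul {f : ℝ → ℝ} (hf : Continuous f) {a : ℝ} (ha : 1 ≤ a)
    (hb : ∀ u, 1 ≤ u → |f u| ≤ u) {s : ℝ} (hs : 0 < s) :
    IntegrableOn (fun u => f u * Real.exp (-s * u)) (Set.Ioi a) := by
  have h1 := (integrableOn_pow_mul_exp_neg_mul_Ioi 1 hs).mono_set
    (Set.Ioi_subset_Ioi (zero_le_one.trans ha))
  refine Integrable.mono' h1 (by fun_prop) ?_
  filter_upwards [ae_restrict_mem measurableSet_Ioi] with u hu
  have hu1 : 1 ≤ u := ha.trans (le_of_lt hu)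
  rw [Real.norm_eq_abs, abs_mul, Real.abs_exp, pow_one]
  exact mul_le_mul_of_nonneg_right (hb u hu1) (Real.exp_pos _).le

theorem abs_buchstabV_le {u : ℝ} (hu : 1 ≤ u) : |buchstabV u| ≤ u := by
  rw [abs_of_nonneg (buchstabV_nonneg u)]
  exact (buchstabV_le u).trans (max_eq_right hu).le

theorem abs_buchstab_le {u : ℝ} (hu : 1 ≤ u) : |buchstab u| ≤ u := by
  rw [abs_of_nonneg (buchstab_nonneg u)]
  exact (buchstab_le_one u).trans hu

theorem mul_buchstab {u : ℝ} (hu : 1 ≤ u) : u * buchstab u = buchstabV u := by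
  rw [buchstab, max_eq_right hu, mul_div_cancel₀ _ (by positivity)]

theorem hasDerivAt_buchstabV {u : ℝ} (hu : 2 < u) :
    HasDerivAt buchstabV (buchstab (u - 1)) u := by
  have h1 : HasDerivAt (fun w => ∫ t in (1 : ℝ)..w, buchstab t) (buchstab (u - 1)) (u - 1) :=
    intervalIntegral.integral_hasDerivAt_right (continuous_buchstab.intervalIntegrable _ _)
      (continuous_buchstab.stronglyMeasurableAtFilter _ _) continuous_buchstab.continuousAt
  have h2 := (h1.comp_sub_const u 1).const_add 1
  refine h2.congr_of_eventuallyEq ?_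
  filter_upwards [Ioi_mem_nhds hu] with w hw
  rw [Set.mem_Ioi] at hw
  rw [buchstabV_eq, max_eq_right (by linarith)]

/-- The Laplace transform of the Buchstab function. -/
noncomputable def buchstabLaplace (s : ℝ) : ℝ :=
  ∫ u in Set.Ioi (1 : ℝ), buchstab u * Real.exp (-s * u)

theorem integral_comp_sub_one_Ioi (f : ℝ → ℝ) :
    ∫ u in Set.Ioi (2 : ℝ), f (u - 1) = ∫ u in Set.Ioi (1 : ℝ), f u := by
  have := (measurePreserving_sub_right (volume : Measure ℝ) 1).setIntegral_preimage_emb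
    (measurableEmbedding_subRight 1) f (Set.Ioi 1)
  rw [← this]
  congr 2
  ext x
  simp only [Set.mem_Ioi, Set.mem_preimage]
  constructor <;> intro h <;> linarith

theorem integrableOn_buchstabV_mul_exp {s : ℝ} (hs : 0 < s) :
    IntegrableOn (fun u => buchstabV u * Real.exp (-s * u)) (Set.Ioi 1) :=
  integrableOn_mul_exp_neg_mul continuous_buchstabV le_rfl (fun _ => abs_buchstabV_le) hs

/-- Integration by parts: V − 1 vanishes on [1, 2] and has derivative ω(u − 1) beyond, so a factor
1/s and, from the shift, a factor e^{−s} come out. -/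
theorem integral_buchstabV_mul_exp {s : ℝ} (hs : 0 < s) :
    ∫ u in Set.Ioi (1 : ℝ), buchstabV u * Real.exp (-s * u) =
      Real.exp (-s) / s * (1 + buchstabLaplace s) := by
  have hexp : IntegrableOn (fun u => Real.exp (-s * u)) (Set.Ioi 1) :=
    integrableOn_exp_mul_Ioi (by linarith) 1
  have hexp1 : ∫ u in Set.Ioi (1 : ℝ), Real.exp (-s * u) = Real.exp (-s) / s := by
    rw [integral_exp_mul_Ioi (by linarith) 1, mul_one, neg_div_neg_eq]
  have hA : IntegrableOn (fun u => (buchstabV u - 1) * Real.exp (-s * u)) (Set.Ioi 1) := by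
    simp only [sub_mul, one_mul]
    exact (integrableOn_buchstabV_mul_exp hs).sub hexp
  have hB : IntegrableOn (fun u => buchstab (u - 1) * Real.exp (-s * u)) (Set.Ioi 2) := by
    refine integrableOn_mul_exp_neg_mul (f := fun u => buchstab (u - 1))
      (continuous_buchstab.comp (by fun_prop)) one_le_two (fun u hu => ?_) hs
    rw [abs_of_nonneg (buchstab_nonneg _)]
    exact (buchstab_le_one _).trans hu
  have e1 : ∫ u in Set.Ioi (1 : ℝ), (buchstabV u - 1) * Real.exp (-s * u) =
      ∫ u in Set.Ioi (2 : ℝ), (buchstabV u - 1) * Real.exp (-s * u) := by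
    refine setIntegral_eq_of_subset_of_forall_sdiff_eq_zero measurableSet_Ioi
      (Set.Ioi_subset_Ioi one_le_two) fun u hu => ?_
    rw [buchstabV_of_le_two (not_lt.1 hu.2), sub_self, zero_mul]
  -- The integrand is the derivative of −(V − 1)e^{−su}/s, which vanishes at 2 and at infinity.
  have e2 : ∫ u in Set.Ioi (2 : ℝ), ((buchstabV u - 1) * Real.exp (-s * u) -
      buchstab (u - 1) * Real.exp (-s * u) / s) = 0 := by
    have hA2 := hA.mono_set (Set.Ioi_subset_Ioi one_le_two)
    have hd : ∀ u ∈ Set.Ioi (2 : ℝ), HasDerivAt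
        (fun u => -((buchstabV u - 1) * Real.exp (-s * u) / s))
        ((buchstabV u - 1) * Real.exp (-s * u) - buchstab (u - 1) * Real.exp (-s * u) / s) u := by
      intro u hu
      have h1 := ((((hasDerivAt_buchstabV hu).sub_const 1).mul
        ((hasDerivAt_id u).const_mul (-s)).exp).div_const s).neg
      refine h1.congr_deriv ?_
      simp only [id]
      field_simp
      ring
    have hc : Continuous fun u => -((buchstabV u - 1) * Real.exp (-s * u) / s) := by
      have := continuous_buchstabV
      fun_prop
    have hlim : Tendsto (fun u => -((buchstabV u - 1) * Real.exp (-s * u) / s)) atTop (𝓝 0) := by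
      have h1 : Tendsto (fun u : ℝ => u * Real.exp (-s * u)) atTop (𝓝 0) := by
        have := tendsto_rpow_mul_exp_neg_mul_atTop_nhds_zero 1 s hs
        simpa only [Real.rpow_one] using this
      have h2 : Tendsto (fun u => (buchstabV u - 1) * Real.exp (-s * u)) atTop (𝓝 0) := by
        refine squeeze_zero_norm' ?_ h1
        filter_upwards [eventually_ge_atTop 1] with u hu
        rw [Real.norm_eq_abs, abs_mul, Real.abs_exp]
        refine mul_le_mul_of_nonneg_right ?_ (Real.exp_pos _).le
        have h3 := buchstabV_nonneg u
        have h4 := abs_le.1 (abs_buchstabV_le hu)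
        rw [abs_le]
        constructor <;> linarith [h4.2]
      simpa using (h2.div_const s).neg
    rw [integral_Ioi_of_hasDerivAt_of_tendsto hc.continuousWithinAt hd
      (hA2.sub (hB.div_const s)) hlim, buchstabV_of_le_two le_rfl]
    simp
  have e3 : ∫ u in Set.Ioi (2 : ℝ), buchstab (u - 1) * Real.exp (-s * u) =
      Real.exp (-s) * buchstabLaplace s := by
    rw [buchstabLaplace, ← integral_const_mul, ← integral_comp_sub_one_Ioi]
    refine integral_congr_ae (Eventually.of_forall fun u => ?_)
    simp only
    rw [mul_left_comm, ← Real.exp_add]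
    congr 2
    ring
  rw [integral_sub (hA.mono_set (Set.Ioi_subset_Ioi one_le_two)) (hB.div_const s),
    integral_div, e3, ← e1] at e2
  simp only [sub_mul, one_mul] at e2
  rw [integral_sub (integrableOn_buchstabV_mul_exp hs) hexp, hexp1] at e2
  linear_combination e2

/-- Differentiating under the integral brings down −u, and u ω(u) = V(u); near s the derivative is
dominated by u e^{−su/2}. -/
theorem hasDerivAt_buchstabLaplace {s : ℝ} (hs : 0 < s) :
    HasDerivAt buchstabLaplace (-(Real.exp (-s) / s * (1 + buchstabLaplace s))) s := by
  rw [← integral_buchstabV_mul_exp hs, ← integral_neg]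
  have hs2 : 0 < s / 2 := by positivity
  refine (hasDerivAt_integral_of_dominated_loc_of_deriv_le
    (F := fun s u => buchstab u * Real.exp (-s * u))
    (F' := fun s u => -(buchstabV u * Real.exp (-s * u)))
    (bound := fun u => u ^ 1 * Real.exp (-(s / 2) * u))
    (Ioi_mem_nhds (show s / 2 < s by linarith)) ?_ ?_ ?_ ?_ ?_ ?_).2
  · refine Eventually.of_forall fun s => ?_
    have := continuous_buchstab
    exact Continuous.aestronglyMeasurable (by fun_prop)
  · exact integrableOn_mul_exp_neg_mul continuous_buchstab le_rfl (fun _ => abs_buchstab_le) hs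
  · have := continuous_buchstabV
    exact Continuous.aestronglyMeasurable (by fun_prop)
  · filter_upwards [ae_restrict_mem measurableSet_Ioi] with u hu r hr
    rw [Set.mem_Ioi] at hu hr
    rw [norm_neg, Real.norm_eq_abs, abs_mul, Real.abs_exp, pow_one]
    refine mul_le_mul (abs_buchstabV_le hu.le) (Real.exp_le_exp.2 ?_) (Real.exp_pos _).le
      (by linarith)
    nlinarith
  · exact (integrableOn_pow_mul_exp_neg_mul_Ioi 1 hs2).mono_set (Set.Ioi_subset_Ioi zero_le_one)
  · filter_upwards [ae_restrict_mem measurableSet_Ioi] with u hu r hr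
    rw [Set.mem_Ioi] at hu
    have h1 := ((((hasDerivAt_id r).neg.mul_const u).exp).const_mul (buchstab u))
    refine h1.congr_deriv ?_
    rw [← mul_buchstab hu.le]
    simp only [id, Pi.neg_apply]
    ring

theorem buchstabLaplace_nonneg (s : ℝ) : 0 ≤ buchstabLaplace s :=
  integral_nonneg fun u => mul_nonneg (buchstab_nonneg u) (Real.exp_pos _).le

theorem tendsto_buchstabLaplace : Tendsto buchstabLaplace atTop (𝓝 0) := by
  have h1 : Tendsto (fun s : ℝ => Real.exp (-s) / s) atTop (𝓝 0) :=
    (Real.tendsto_exp_neg_atTop_nhds_zero).div_atTop tendsto_id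
  refine squeeze_zero' (Eventually.of_forall buchstabLaplace_nonneg) ?_ h1
  filter_upwards [eventually_gt_atTop 0] with s hs
  have hexp1 : ∫ u in Set.Ioi (1 : ℝ), Real.exp (-s * u) = Real.exp (-s) / s := by
    rw [integral_exp_mul_Ioi (by linarith) 1, mul_one, neg_div_neg_eq]
  rw [← hexp1]
  refine integral_mono (integrableOn_mul_exp_neg_mul continuous_buchstab le_rfl
    (fun _ => abs_buchstab_le) hs) (integrableOn_exp_mul_Ioi (by linarith) 1) fun u => ?_
  exact mul_le_of_le_one_left (Real.exp_pos _).le (buchstab_le_one u)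

/-- By the differential equation −log(1 + L) has derivative e^{−s}/s, and it vanishes at infinity.
-/
theorem exp_expIntegral {s : ℝ} (hs : 0 < s) :
    Real.exp (expIntegral s) = 1 + buchstabLaplace s := by
  have hpos : ∀ r, 0 < 1 + buchstabLaplace r := fun r => by linarith [buchstabLaplace_nonneg r]
  have hd : ∀ r ∈ Set.Ici s, HasDerivAt (fun r => -Real.log (1 + buchstabLaplace r))
      (Real.exp (-r) / r) r := by
    intro r hr
    have hr0 : 0 < r := hs.trans_le hr
    refine (((hasDerivAt_buchstabLaplace hr0).const_add 1).log (hpos r).ne').neg.congr_deriv ?_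
    have := (hpos r).ne'
    field_simp
  have hlim : Tendsto (fun r => -Real.log (1 + buchstabLaplace r)) atTop (𝓝 0) := by
    have h1 := (tendsto_buchstabLaplace.const_add 1)
    rw [add_zero] at h1
    have h2 := (h1.log one_ne_zero).neg
    simpa using h2
  have h := integral_Ioi_of_hasDerivAt_of_nonneg' hd (fun r hr => by
    have hr0 : 0 < r := hs.trans hr
    positivity) hlim
  rw [expIntegral, h, zero_sub, neg_neg, Real.exp_log (hpos s)]

theorem pow_mul_exp_expIntegral_sub (k : ℕ) {s : ℝ} (hs : 0 < s) :
    s ^ k * Real.exp (expIntegral s - s) =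
      ∫ u in Set.Ioi (1 : ℝ), s ^ (k + 1) * (buchstabV u * Real.exp (-s * u)) := by
  rw [integral_const_mul, integral_buchstabV_mul_exp hs, ← exp_expIntegral hs, sub_eq_add_neg,
    Real.exp_add]
  field_simp
  ring

/-! ### The constant as a moment integral of V -/

theorem integrableOn_buchstabV_div_pow (k : ℕ) :
    IntegrableOn (fun u => buchstabV u / u ^ (k + 3)) (Set.Ioi 1) := by
  have h1 : IntegrableOn (fun u : ℝ => u ^ (-2 : ℝ)) (Set.Ioi 1) :=
    integrableOn_Ioi_rpow_of_lt (by norm_num) one_pos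
  refine Integrable.mono' h1 ?_ ?_
  · refine ContinuousOn.aestronglyMeasurable ?_ measurableSet_Ioi
    refine continuous_buchstabV.continuousOn.div (by fun_prop) fun u hu => ?_
    have : 0 < u := one_pos.trans hu
    positivity
  · filter_upwards [ae_restrict_mem measurableSet_Ioi] with u hu
    rw [Set.mem_Ioi] at hu
    have hu0 : 0 < u := by linarith
    have h2 : u ^ (-2 : ℝ) = u / u ^ 3 := by
      rw [Real.rpow_neg hu0.le]
      norm_num
      field_simp
    rw [Real.norm_eq_abs, abs_div, abs_of_pos (by positivity : 0 < u ^ (k + 3)), h2]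
    refine div_le_div₀ hu0.le (abs_buchstabV_le hu.le) (by positivity) ?_
    exact pow_le_pow_right₀ hu.le (by omega)

/-- All factors are nonnegative, so integrating in s first leaves (k + 2)! V(u)/u^{k+3}, which is
integrable since V(u) ≤ u. -/
theorem integrable_prod_buchstab (k : ℕ) :
    Integrable (fun p : ℝ × ℝ => p.1 ^ (k + 2) * (buchstabV p.2 * Real.exp (-p.1 * p.2)))
      ((volume.restrict (Set.Ioi 0)).prod (volume.restrict (Set.Ioi 1))) := by
  have hc : Continuous fun p : ℝ × ℝ =>
      p.1 ^ (k + 2) * (buchstabV p.2 * Real.exp (-p.1 * p.2)) := by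
    have := continuous_buchstabV.comp (continuous_snd (X := ℝ) (Y := ℝ))
    simp only [Function.comp_def] at this
    fun_prop
  have e : ∀ s u : ℝ, s ^ (k + 2) * (buchstabV u * Real.exp (-s * u)) =
      buchstabV u * (s ^ (k + 2) * Real.exp (-u * s)) := by
    intro s u
    rw [show -s * u = -u * s by ring]; ring
  rw [integrable_prod_iff' hc.aestronglyMeasurable]
  constructor
  · filter_upwards [ae_restrict_mem measurableSet_Ioi] with u hu
    have hu0 : (0 : ℝ) < u := one_pos.trans hu
    simp only [e]
    exact (integrableOn_pow_mul_exp_neg_mul_Ioi (k + 2) hu0).const_mul _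
  · refine ((integrableOn_buchstabV_div_pow k).const_mul ((k + 2).factorial : ℝ)).congr ?_
    filter_upwards [ae_restrict_mem measurableSet_Ioi] with u hu
    have hu0 : (0 : ℝ) < u := one_pos.trans hu
    have h1 : ∫ s in Set.Ioi (0 : ℝ), ‖s ^ (k + 2) * (buchstabV u * Real.exp (-s * u))‖ =
        ∫ s in Set.Ioi (0 : ℝ), buchstabV u * (s ^ (k + 2) * Real.exp (-u * s)) := by
      refine setIntegral_congr_fun measurableSet_Ioi fun s hs => ?_
      rw [e, Real.norm_of_nonneg]
      have : 0 < s := hs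
      have := buchstabV_nonneg u
      positivity
    simp only [h1]
    rw [integral_const_mul, integral_pow_mul_exp_neg_mul_Ioi _ hu0]
    ring

theorem integrableOn_pow_mul_exp_expIntegral_sub (k : ℕ) :
    IntegrableOn (fun x : ℝ => x ^ (k + 1) * Real.exp (expIntegral x - x)) (Set.Ioi 0) := by
  refine (integrable_prod_buchstab k).integral_prod_left.congr ?_
  filter_upwards [ae_restrict_mem measurableSet_Ioi] with s hs
  exact (pow_mul_exp_expIntegral_sub (k + 1) hs).symm

theorem integral_pow_mul_exp_expIntegral_sub (k : ℕ) :
    ∫ x in Set.Ioi (0 : ℝ), x ^ (k + 1) * Real.exp (expIntegral x - x) =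
      (k + 2).factorial * ∫ u in Set.Ioi (1 : ℝ), buchstabV u / u ^ (k + 3) := by
  have h1 := integral_integral_swap
    (f := fun s u : ℝ => s ^ (k + 2) * (buchstabV u * Real.exp (-s * u))) (integrable_prod_buchstab k)
  rw [setIntegral_congr_fun measurableSet_Ioi
    (fun s hs => pow_mul_exp_expIntegral_sub (k + 1) hs)]
  refine h1.trans ?_
  rw [← integral_const_mul]
  refine setIntegral_congr_fun measurableSet_Ioi fun u hu => ?_
  have hu0 : (0 : ℝ) < u := one_pos.trans hu
  have e : ∀ s : ℝ, s ^ (k + 2) * (buchstabV u * Real.exp (-s * u)) =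
      buchstabV u * (s ^ (k + 2) * Real.exp (-u * s)) := by
    intro s
    rw [show -s * u = -u * s by ring]; ring
  simp only [e]
  rw [integral_const_mul, integral_pow_mul_exp_neg_mul_Ioi _ hu0]
  ring

/-! ### Limit of the tail sums for h ≥ 2 -/

theorem tendsto_natCast_div_ceil {y : ℝ} (hy : 0 < y) :
    Tendsto (fun n : ℕ => (n : ℝ) / (⌈y * n⌉₊ : ℝ)) atTop (𝓝 y⁻¹) := by
  have h := ((tendsto_nat_ceil_mul_div_atTop hy.le).comp
    (tendsto_natCast_atTop_atTop (R := ℝ))).inv₀ hy.ne'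
  simpa [Function.comp_def] using h

/-- With m = ⌈yn⌉ the ratio n/m never exceeds 1/y, so a single error constant serves every n. -/
theorem tendsto_mul_longCycleProb_ceil {y : ℝ} (hy : 0 < y) (hy1 : y ≤ 1) :
    Tendsto (fun n : ℕ => n * longCycleProb ⌈y * n⌉₊ n) atTop (𝓝 (buchstabV y⁻¹)) := by
  obtain ⟨C, hC, hb⟩ := exists_abs_mul_longCycleProb_sub_le ⌈y⁻¹⌉₊
  have h1 : Tendsto (fun n : ℕ => buchstabV ((n : ℝ) / (⌈y * n⌉₊ : ℝ))) atTop
      (𝓝 (buchstabV y⁻¹)) :=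
    (continuous_buchstabV.tendsto _).comp (tendsto_natCast_div_ceil hy)
  have h2 : Tendsto (fun n : ℕ => n * longCycleProb ⌈y * n⌉₊ n -
      buchstabV ((n : ℝ) / (⌈y * n⌉₊ : ℝ))) atTop (𝓝 0) := by
    refine squeeze_zero_norm' (a := fun n : ℕ => C / y / n) ?_
      (tendsto_const_div_atTop_nhds_zero_nat _)
    filter_upwards [eventually_gt_atTop 0] with n hn
    have hnR : (0 : ℝ) < n := by positivity
    have hyn : 0 < y * n := by positivity
    have hm : 0 < ⌈y * n⌉₊ := Nat.ceil_pos.2 hyn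
    have hle : y * n ≤ ⌈y * n⌉₊ := Nat.le_ceil _
    refine (hb ⌈y * n⌉₊ n hm (Nat.ceil_le.2 (mul_le_of_le_one_left hnR.le hy1)) ?_).trans ?_
    · have h3 : (n : ℝ) ≤ (⌈y⁻¹⌉₊ : ℝ) * ⌈y * n⌉₊ := by
        calc (n : ℝ) = y⁻¹ * (y * n) := by field_simp
          _ ≤ _ := mul_le_mul (Nat.le_ceil _) hle hyn.le (Nat.cast_nonneg _)
      exact_mod_cast h3
    · rw [div_div]
      exact div_le_div_of_nonneg_left hC hyn hle
  simpa using h2.add h1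

/-- Domination for the limit: the factor y^{k+1} absorbs 1/y. -/
theorem abs_mul_longCycleProb_ceil_le {y : ℝ} (hy : 0 < y) (n : ℕ) :
    |n * longCycleProb ⌈y * n⌉₊ n| ≤ y⁻¹ := by
  rcases Nat.eq_zero_or_pos n with rfl | hn
  · simpa using hy.le
  · have hyn : 0 < y * n := by positivity
    have hm : 0 < ⌈y * n⌉₊ := Nat.ceil_pos.2 hyn
    rw [abs_of_nonneg (mul_nonneg (Nat.cast_nonneg n) (longCycleProb_nonneg _ _))]
    calc n * longCycleProb ⌈y * n⌉₊ n ≤ n * (1 / ⌈y * n⌉₊) := by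
          gcongr; exact longCycleProb_le hm hn
      _ ≤ n * (1 / (y * n)) := by gcongr; exact Nat.le_ceil _
      _ = y⁻¹ := by field_simp

theorem tendsto_integral_longCycleProb_ceil (k : ℕ) :
    Tendsto (fun n : ℕ => ∫ y in (0 : ℝ)..1,
        ((k + 2 : ℕ) : ℝ) * y ^ (k + 1) * (n * longCycleProb ⌈y * n⌉₊ n)) atTop
      (𝓝 (∫ y in (0 : ℝ)..1, ((k + 2 : ℕ) : ℝ) * y ^ (k + 1) * buchstabV y⁻¹)) := by
  refine intervalIntegral.tendsto_integral_filter_of_dominated_convergence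
    (fun y => ((k + 2 : ℕ) : ℝ) * y ^ k) (Eventually.of_forall fun n => ?_)
    (Eventually.of_forall fun n => Eventually.of_forall fun y hy => ?_)
    ((by fun_prop : Continuous fun y : ℝ => ((k + 2 : ℕ) : ℝ) * y ^ k).intervalIntegrable _ _)
    (Eventually.of_forall fun y hy => ?_)
  · have h1 : Measurable fun y : ℝ => longCycleProb ⌈y * n⌉₊ n :=
      (measurable_from_nat (f := fun m => longCycleProb m n)).comp
        (Nat.measurable_ceil.comp (measurable_id.mul_const (n : ℝ)))
    exact Measurable.aestronglyMeasurable (by fun_prop)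
  · rw [Set.uIoc_of_le zero_le_one] at hy
    have hy0 : 0 < y := hy.1
    rw [Real.norm_eq_abs, abs_mul, abs_of_pos (by positivity)]
    refine (mul_le_mul_of_nonneg_left (abs_mul_longCycleProb_ceil_le hy0 n)
      (by positivity)).trans (le_of_eq ?_)
    rw [pow_succ]
    field_simp
  · rw [Set.uIoc_of_le zero_le_one] at hy
    exact (tendsto_mul_longCycleProb_ceil hy.1 hy.2).const_mul _

/-- The ceiling is constant, equal to i + 1, on (i/n, (i+1)/n], so the identity is exact. -/
theorem integral_longCycleProb_ceil (k : ℕ) {n : ℕ} (hn : 0 < n) :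
    ∫ y in (0 : ℝ)..1, ((k + 2 : ℕ) : ℝ) * y ^ (k + 1) * (n * longCycleProb ⌈y * n⌉₊ n) =
      (∑ i ∈ Finset.range n,
        (((i : ℝ) + 1) ^ (k + 2) - (i : ℝ) ^ (k + 2)) * longCycleProb (i + 1) n) /
          (n : ℝ) ^ (k + 1) := by
  have hnR : (0 : ℝ) < n := by positivity
  have hceil : ∀ i : ℕ, ∀ y ∈ Set.uIoc ((i : ℝ) / n) (((i + 1 : ℕ) : ℝ) / n),
      ⌈y * n⌉₊ = i + 1 := by
    intro i y hy
    rw [Set.uIoc_of_le (by gcongr; omega), Set.mem_Ioc, div_lt_iff₀ hnR, le_div_iff₀ hnR] at hy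
    rw [Nat.ceil_eq_iff (by omega), Nat.add_sub_cancel]
    exact hy
  have hcont : ∀ c : ℝ, Continuous fun y : ℝ => ((k + 2 : ℕ) : ℝ) * y ^ (k + 1) * c := by
    intro c; fun_prop
  have heq : ∀ i : ℕ, Set.EqOn
      (fun y : ℝ => ((k + 2 : ℕ) : ℝ) * y ^ (k + 1) * (n * longCycleProb (i + 1) n))
      (fun y : ℝ => ((k + 2 : ℕ) : ℝ) * y ^ (k + 1) * (n * longCycleProb ⌈y * n⌉₊ n))
      (Set.uIoc ((i : ℝ) / n) (((i + 1 : ℕ) : ℝ) / n)) := by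
    intro i y hy
    simp only [hceil i y hy]
  have hint : ∀ i < n, IntervalIntegrable
      (fun y : ℝ => ((k + 2 : ℕ) : ℝ) * y ^ (k + 1) * (n * longCycleProb ⌈y * n⌉₊ n)) volume
      ((i : ℝ) / n) (((i + 1 : ℕ) : ℝ) / n) := fun i _ =>
    ((hcont (n * longCycleProb (i + 1) n)).intervalIntegrable _ _).congr (heq i)
  have h1 := intervalIntegral.sum_integral_adjacent_intervals
    (a := fun i : ℕ => (i : ℝ) / n) hint
  rw [Nat.cast_zero, zero_div, div_self hnR.ne'] at h1
  rw [← h1, Finset.sum_div]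
  refine Finset.sum_congr rfl fun i _ => ?_
  rw [← intervalIntegral.integral_congr_ae (Eventually.of_forall (heq i)),
    intervalIntegral.integral_mul_const, intervalIntegral.integral_const_mul, integral_pow,
    div_pow, div_pow]
  push_cast
  field_simp
  ring

theorem integral_buchstabV_inv (k : ℕ) :
    ∫ y in (0 : ℝ)..1, ((k + 2 : ℕ) : ℝ) * y ^ (k + 1) * buchstabV y⁻¹ =
      (k + 2 : ℕ) * ∫ u in Set.Ioi (1 : ℝ), buchstabV u / u ^ (k + 3) := by
  have himg : (fun x : ℝ => x⁻¹) '' Set.Ioo 0 1 = Set.Ioi 1 := by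
    rw [Set.image_inv_eq_inv, Set.inv_Ioo_0_left one_pos, inv_one]
  have h := integral_image_eq_integral_abs_deriv_smul (f := fun x : ℝ => x⁻¹)
    (f' := fun x : ℝ => -(x ^ 2)⁻¹) (s := Set.Ioo 0 1) measurableSet_Ioo
    (fun x hx => (hasDerivAt_inv hx.1.ne').hasDerivWithinAt) inv_injective.injOn
    (fun u => buchstabV u / u ^ (k + 3))
  rw [himg] at h
  rw [h, intervalIntegral.integral_of_le zero_le_one, integral_Ioc_eq_integral_Ioo,
    ← integral_const_mul]
  refine setIntegral_congr_fun measurableSet_Ioo fun y hy => ?_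
  have hy0 : 0 < y := hy.1
  simp only [smul_eq_mul]
  rw [abs_neg, abs_of_pos (by positivity), inv_pow]
  field_simp
  ring

theorem tendsto_sum_longCycleProb_div_pow (k : ℕ) :
    Tendsto (fun n : ℕ => (∑ i ∈ Finset.range n,
        (((i : ℝ) + 1) ^ (k + 2) - (i : ℝ) ^ (k + 2)) * longCycleProb (i + 1) n) /
          (n : ℝ) ^ (k + 1)) atTop (𝓝 (shortestCycleConst (k + 2))) := by
  have hconst : shortestCycleConst (k + 2) =
      ∫ y in (0 : ℝ)..1, ((k + 2 : ℕ) : ℝ) * y ^ (k + 1) * buchstabV y⁻¹ := by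
    rw [integral_buchstabV_inv, shortestCycleConst, show k + 2 - 1 = k + 1 by omega,
      integral_pow_mul_exp_expIntegral_sub, Nat.factorial_succ (k + 1)]
    push_cast
    field_simp
    ring
  rw [hconst]
  refine (tendsto_integral_longCycleProb_ceil k).congr' ?_
  filter_upwards [eventually_gt_atTop 0] with n hn
  exact integral_longCycleProb_ceil k hn

/-! ### Moments and variance -/

/-- Starting the sum at length 1 adds the term `longCycleProb 1 n`, subtracted again in front; this
bounded correction disappears after division by a divergent g. -/
theorem shortestCycleMoment_eq_sum_range {h : ℕ} (hh : 0 < h) {n : ℕ} (hn : 0 < n) :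
    shortestCycleMoment h n = (longCycleProb 2 n - longCycleProb 1 n + ∑ i ∈ Finset.range n,
      (((i : ℝ) + 1) ^ h - (i : ℝ) ^ h) * longCycleProb (i + 1) n) / longCycleProb 2 n := by
  rw [shortestCycleMoment_eq h hn]
  congr 1
  obtain ⟨N, rfl⟩ := Nat.exists_eq_succ_of_ne_zero hn.ne'
  have h1 : ∑ i ∈ Finset.Icc 2 (N + 1),
      ((i : ℝ) ^ h - ((i : ℝ) - 1) ^ h) * longCycleProb i (N + 1) =
      ∑ i ∈ Finset.range N, (((i + 1 : ℕ) : ℝ) + 1) ^ h * longCycleProb (i + 1 + 1) (N + 1) -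
      ∑ i ∈ Finset.range N, ((i + 1 : ℕ) : ℝ) ^ h * longCycleProb (i + 1 + 1) (N + 1) := by
    rw [← Finset.sum_sub_distrib, ← Finset.Ico_add_one_right_eq_Icc, Finset.sum_Ico_eq_sum_range]
    refine Finset.sum_congr (by congr 1) fun i _ => ?_
    rw [show 2 + i = i + 1 + 1 by omega]
    push_cast
    ring
  rw [Nat.succ_eq_add_one, h1, Finset.sum_range_succ', ← Finset.sum_sub_distrib]
  simp only [sub_mul, Nat.cast_zero, zero_add, one_pow, zero_pow hh.ne', sub_zero, one_mul]
  ring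

theorem tendsto_longCycleProb_two :
    Tendsto (longCycleProb 2) atTop (𝓝 (Real.exp (-1))) := by
  simpa [harmonic] using tendsto_longCycleProb 1

theorem tendsto_longCycleProb_one : Tendsto (longCycleProb 1) atTop (𝓝 1) := by
  simpa [harmonic] using tendsto_longCycleProb 0

theorem tendsto_shortestCycleMoment_div {h : ℕ} (hh : 0 < h) {g : ℕ → ℝ} {c : ℝ}
    (hg : Tendsto g atTop atTop)
    (hc : Tendsto (fun n : ℕ => (∑ i ∈ Finset.range n,
      (((i : ℝ) + 1) ^ h - (i : ℝ) ^ h) * longCycleProb (i + 1) n) / g n) atTop (𝓝 c)) :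
    Tendsto (fun n : ℕ => shortestCycleMoment h n / g n) atTop (𝓝 (Real.exp 1 * c)) := by
  have h1 := (tendsto_longCycleProb_two.sub tendsto_longCycleProb_one).div_atTop hg
  have h2 := (h1.add hc).div tendsto_longCycleProb_two (Real.exp_pos _).ne'
  rw [zero_add, Real.exp_neg, div_inv_eq_mul, mul_comm] at h2
  refine h2.congr' ?_
  filter_upwards [eventually_gt_atTop 0] with n hn
  rw [shortestCycleMoment_eq_sum_range hh hn]
  simp only [Pi.div_apply]
  ring

theorem tendsto_shortestCycleMoment_one :
    Tendsto (fun n : ℕ => shortestCycleMoment 1 n / Real.log (n : ℝ)) atTop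
      (𝓝 (Real.exp (1 - Real.eulerMascheroniConstant))) := by
  rw [sub_eq_add_neg, Real.exp_add]
  refine tendsto_shortestCycleMoment_div one_pos
    (Real.tendsto_log_atTop.comp tendsto_natCast_atTop_atTop) ?_
  simpa using tendsto_sum_longCycleProb_div_log

theorem tendsto_shortestCycleMoment_of_two_le {h : ℕ} (hh : 2 ≤ h) :
    Tendsto (fun n : ℕ => shortestCycleMoment h n / (n : ℝ) ^ (h - 1)) atTop
      (𝓝 (Real.exp 1 * shortestCycleConst h)) := by
  obtain ⟨k, rfl⟩ := Nat.exists_eq_add_of_le' hh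
  rw [show k + 2 - 1 = k + 1 by omega]
  exact tendsto_shortestCycleMoment_div (by omega)
    ((tendsto_pow_atTop (by omega)).comp tendsto_natCast_atTop_atTop)
    (tendsto_sum_longCycleProb_div_pow k)

theorem shortestCycleVariance_eq {n : ℕ} (hn : 0 < n) (h2 : longCycleProb 2 n ≠ 0) :
    shortestCycleVariance n = shortestCycleMoment 2 n - shortestCycleMoment 1 n ^ 2 := by
  have hcard : (Fintype.card (derangements (Fin n)) : ℝ) ≠ 0 := by
    rw [card_derangements_eq_mul hn]
    exact mul_ne_zero (by positivity) h2
  have hm : ∑ σ : derangements (Fin n), (shortestCycle (σ : Equiv.Perm (Fin n)) : ℝ) =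
      shortestCycleMoment 1 n * Fintype.card (derangements (Fin n)) := by
    rw [shortestCycleMoment, derangementMean, div_mul_cancel₀ _ hcard]
    simp only [pow_one]
  rw [shortestCycleVariance, derangementMean, shortestCycleMoment.eq_1 2, derangementMean,
    eq_sub_iff_add_eq, div_add' _ _ _ hcard]
  congr 1
  simp only [sub_sq]
  rw [Finset.sum_add_distrib, Finset.sum_sub_distrib, ← Finset.sum_mul, ← Finset.mul_sum, hm,
    Finset.sum_const, Finset.card_univ, nsmul_eq_mul]
  ring

theorem tendsto_shortestCycleVariance :
    Tendsto (fun n : ℕ => shortestCycleVariance n / (n : ℝ)) atTop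
      (𝓝 (Real.exp 1 * shortestCycleConst 2)) := by
  have h1 : Tendsto (fun n : ℕ => Real.log (n : ℝ) ^ 2 / n) atTop (𝓝 0) :=
    (Real.isLittleO_pow_log_id_atTop (n := 2)).tendsto_div_nhds_zero.comp
      tendsto_natCast_atTop_atTop
  have h2 := (tendsto_shortestCycleMoment_one.pow 2).mul h1
  have h3 := (tendsto_shortestCycleMoment_of_two_le le_rfl).sub h2
  rw [mul_zero, sub_zero] at h3
  refine h3.congr' ?_
  -- The variance identity needs derangements to exist, which holds eventually because p_2(n) → 1/e
  -- ≠ 0.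
  filter_upwards [eventually_gt_atTop 1,
    tendsto_longCycleProb_two.eventually_ne (Real.exp_pos _).ne'] with n hn hne
  have hlog : Real.log n ≠ 0 := (Real.log_pos (by exact_mod_cast hn)).ne'
  rw [shortestCycleVariance_eq (by omega) hne]
  norm_num
  field_simp

theorem mainTheorem3 :
    Filter.Tendsto (fun n : ℕ => shortestCycleMoment 1 n / Real.log (n : ℝ)) Filter.atTop
      (nhds (Real.exp (1 - Real.eulerMascheroniConstant))) ∧
    (∀ h : ℕ, 2 ≤ h →
      MeasureTheory.IntegrableOn
        (fun x : ℝ => x ^ (h - 1) * Real.exp (expIntegral x - x)) (Set.Ioi 0) ∧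
      Filter.Tendsto (fun n : ℕ => shortestCycleMoment h n / (n : ℝ) ^ (h - 1)) Filter.atTop
        (nhds (Real.exp 1 * shortestCycleConst h))) ∧
    Filter.Tendsto (fun n : ℕ => shortestCycleVariance n / (n : ℝ)) Filter.atTop
      (nhds (Real.exp 1 * shortestCycleConst 2)) := by
  refine ⟨tendsto_shortestCycleMoment_one, fun h hh => ⟨?_,
    tendsto_shortestCycleMoment_of_two_le hh⟩, tendsto_shortestCycleVariance⟩
  obtain ⟨k, rfl⟩ := Nat.exists_eq_add_of_le' hh
  exact integrableOn_pow_mul_exp_expIntegral_sub k
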